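/- Let $\Omega\subset\mathbb{R}^3$ be a bounded domain with analytic boundary $\Gamma=\partial\Omega$ that is star-shaped with respect to a ball. Let $V=H^1(\Omega)$ (complex-valued), let $(\cdot,\cdot)$ and $(\cdot,\cdot)_\Gamma$ be the scalar products of $L^2(\Omega)$ (also of $L^2(\Omega)^3$) and $L^2(\Gamma)$, conjugate-linear in the second argument, let $\|\cdot\|$ be the $L^2(\Omega)$-norm, and let $\gamma_0:V\to L^2(\Gamma)$ be the trace operator. For $\zeta\in\mathbb{C}$ and $\rho>0$ put $$b_\zeta(\gamma_0u,\gamma_0v)=(\zeta\gamma_0u,\gamma_0v)_\Gamma,\qquad a_\zeta(u,v)=(\nabla u,\nabla v)+(\zeta^2u,v)+b_\zeta(\gamma_0u,\gamma_0v),\qquad \|u\|_\rho=\bigl(\|\nabla u\|^2+\rho^2\|u\|^2\bigr)^{1/2}.$$ The trace operator is well defined: for every $u\in V$ there is exactly one $\gamma_0u\in L^2(\Gamma)$ which is the limit in $L^2(\Gamma)$ of $\varphi_n|_\Gamma$ for some $\varphi_n\in C^\infty(\mathbb{R}^3)$ with $\varphi_n|_\Omega\to u$ in $H^1(\Omega)$.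 There is a constant $C_b\ge0$, depending only on $\Omega$, such that for all $\zeta\in\mathbb{C}$ with $\operatorname{Re}\zeta\ge0$, $|\zeta|\ge1$ and all $u,v\in V$ $$|b_\zeta(\gamma_0u,\gamma_0v)|\le C_b\|u\|_{|\zeta|}\|v\|_{|\zeta|}\quad\text{and}\quad |a_\zeta(u,v)|\le(1+C_b)\|u\|_{|\zeta|}\|v\|_{|\zeta|}.\tag{1}$$ Let $C_b$ be any real constant for which the second inequality in (1) holds for all such $\zeta,u,v$. Let $\operatorname{Re}\zeta>0$, $|\zeta|\ge1$, and let $S\subset V$ be a closed subspace. Then for every $f\in L^2(\Omega)$ the adjoint problem $a_{\overline\zeta}(z,w)=(f,w)$ for all $w\in V$ has a unique solution $z=:\tilde S_\zeta f\in V$, and the adjoint approximability $$\eta(S)=\sup_{f\in L^2(\Omega)\setminus\{0\}}\ \inf_{v\in S}\frac{\|\tilde S_\zeta f-v\|_{|\zeta|}}{\|f\|}$$ is finite. Moreover, for every $u\in V$ there exists a unique $u_S\in S$ with $a_\zeta(u-u_S,v)=0$ for all $v\in S$, and $$\|u-u_S\|_{|\zeta|}\le\frac{|\zeta|}{\operatorname{Re}\zeta}(1+C_b)\inf_{v\in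 S}\|u-v\|_{|\zeta|},\qquad \|u-u_S\|\le(1+C_b)\,\eta(S)\,\|u-u_S\|_{|\zeta|}.$$ -/

import Mathlib

open MeasureTheory Filter Topology
open scoped ContDiff ENNReal

noncomputable section

namespace LossyHelmholtz

/-- Euclidean three-space. -/
abbrev R3 : Type := EuclideanSpace ℝ (Fin 3)

/-- Three-dimensional complex vectors, the values of gradients. -/
abbrev C3 : Type := EuclideanSpace ℂ (Fin 3)

/-- The boundary of `Ω` is (real) analytic: near each boundary point, `Ω` is the negative set
of a real-analytic function without critical points. -/
def HasAnalyticBoundary (Ω : Set R3) : Prop :=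
  ∀ x ∈ frontier Ω, ∃ U : Set R3, IsOpen U ∧ x ∈ U ∧ ∃ g : R3 → ℝ,
    AnalyticOnNhd ℝ g U ∧ (∀ y ∈ U, fderiv ℝ g y ≠ 0) ∧ Ω ∩ U = {y ∈ U | g y < 0}

/-- `Ω` is star-shaped with respect to every point of some ball contained in `Ω`. -/
def IsStarShapedWrtBall (Ω : Set R3) : Prop :=
  ∃ (x₀ : R3) (ρ : ℝ), 0 < ρ ∧ Metric.ball x₀ ρ ⊆ Ω ∧
    ∀ y ∈ Metric.ball x₀ ρ, StarConvex ℝ y Ω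

/-- Bounded domains of `ℝ³` with analytic boundary that are star-shaped with respect to a ball
(nonemptiness and connectedness follow from the last condition). -/
structure IsAdmissibleDomain (Ω : Set R3) : Prop where
  isOpen : IsOpen Ω
  isBounded : Bornology.IsBounded Ω
  analyticBoundary : HasAnalyticBoundary Ω
  starShaped : IsStarShapedWrtBall Ω

/-- `L²(Ω)` with complex values. -/
abbrev L2 (Ω : Set R3) : Type := Lp ℂ 2 (volume.restrict Ω)

/-- `L²(Ω)³` with complex values. -/
abbrev L2Vec (Ω : Set R3) : Type := Lp C3 2 (volume.restrict Ω)

/-- The surface measure on `Γ = ∂Ω`: the two-dimensional Hausdorff measure, normalised so that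
it is Lebesgue measure on planes, restricted to the frontier. -/
def surfaceMeasure (Ω : Set R3) : Measure R3 :=
  (Measure.euclideanHausdorffMeasure 2 : Measure R3).restrict (frontier Ω)

/-- `L²(Γ)` with complex values. -/
abbrev L2Bdry (Ω : Set R3) : Type := Lp ℂ 2 (surfaceMeasure Ω)

/-- The partial derivative `∂ᵢ φ`. -/
def partialDeriv {F : Type*} [NormedAddCommGroup F] [NormedSpace ℝ F]
    (i : Fin 3) (φ : R3 → F) (x : R3) : F :=
  fderiv ℝ φ x (EuclideanSpace.single i (1 : ℝ))

/-- The classical gradient of a complex-valued function. -/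
def classicalGrad (φ : R3 → ℂ) (x : R3) : C3 :=
  WithLp.toLp 2 fun i => partialDeriv i φ x

/-- Test functions: smooth, real-valued, with compact support in `Ω`. -/
structure IsTestFunction (Ω : Set R3) (φ : R3 → ℝ) : Prop where
  contDiff : ContDiff ℝ ∞ φ
  hasCompactSupport : HasCompactSupport φ
  tsupport_subset : tsupport φ ⊆ Ω

/-- `G` is the weak (distributional) gradient of `u` in `Ω`. -/
def IsWeakGrad (Ω : Set R3) (u : L2 Ω) (G : L2Vec Ω) : Prop :=
  ∀ φ : R3 → ℝ, IsTestFunction Ω φ → ∀ i : Fin 3,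
    ∫ x in Ω, u x * ((partialDeriv i φ x : ℝ) : ℂ) = - ∫ x in Ω, (G x) i * (φ x : ℂ)

lemma IsTestFunction.memLp {Ω : Set R3} {φ : R3 → ℝ} (h : IsTestFunction Ω φ)
    (μ : Measure R3) [IsFiniteMeasureOnCompacts μ] : MemLp (fun x => (φ x : ℂ)) 2 μ :=
  (Complex.continuous_ofReal.comp h.contDiff.continuous).memLp_of_hasCompactSupport
    (h.hasCompactSupport.comp_left (g := fun t : ℝ => (t : ℂ)) Complex.ofReal_zero)

lemma IsTestFunction.memLp_partialDeriv {Ω : Set R3} {φ : R3 → ℝ} (h : IsTestFunction Ω φ)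
    (i : Fin 3) (μ : Measure R3) [IsFiniteMeasureOnCompacts μ] :
    MemLp (fun x => ((partialDeriv i φ x : ℝ) : ℂ)) 2 μ := by
  have hc : Continuous (partialDeriv i φ) :=
    (h.contDiff.continuous_fderiv (by simp)).clm_apply continuous_const
  have hs : HasCompactSupport (partialDeriv i φ) :=
    (h.hasCompactSupport.fderiv ℝ).comp_left (g := fun T : R3 →L[ℝ] ℝ =>
      T (EuclideanSpace.single i (1 : ℝ))) rfl
  exact (Complex.continuous_ofReal.comp hc).memLp_of_hasCompactSupport
    (hs.comp_left (g := fun t : ℝ => (t : ℂ)) Complex.ofReal_zero)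

lemma memLp_coord {Ω : Set R3} (G : L2Vec Ω) (i : Fin 3) :
    MemLp (fun x => (G x) i) 2 (volume.restrict Ω) :=
  (EuclideanSpace.proj (𝕜 := ℂ) i : C3 →L[ℂ] ℂ).comp_memLp' (Lp.memLp G)

/-- The Sobolev space `H¹(Ω)`. Since the weak gradient is unique, a function is identified with
the pair of the function and its weak gradient; the norm inherited from the product is the usual
one, `(‖u‖² + ‖∇u‖²)^{1/2}`. -/
def H1 (Ω : Set R3) : Submodule ℂ (WithLp 2 (L2 Ω × L2Vec Ω)) where
  carrier := {p | IsWeakGrad Ω p.fst p.snd}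
  zero_mem' := by
    intro φ _ i
    have h1 : ∫ x in Ω, ((0 : L2 Ω) x) * ((partialDeriv i φ x : ℝ) : ℂ) = 0 := by
      refine integral_eq_zero_of_ae ?_
      filter_upwards [Lp.coeFn_zero ℂ 2 (volume.restrict Ω)] with x hx
      rw [hx]; simp
    have h2 : ∫ x in Ω, ((0 : L2Vec Ω) x) i * (φ x : ℂ) = 0 := by
      refine integral_eq_zero_of_ae ?_
      filter_upwards [Lp.coeFn_zero C3 2 (volume.restrict Ω)] with x hx
      rw [hx]; simp
    exact h1.trans (by rw [WithLp.zero_snd, h2, neg_zero])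
  add_mem' := by
    intro p q hp hq φ hφ i
    have h1 : ∫ x in Ω, ((p.fst + q.fst : L2 Ω) x) * ((partialDeriv i φ x : ℝ) : ℂ)
        = (∫ x in Ω, p.fst x * ((partialDeriv i φ x : ℝ) : ℂ))
          + ∫ x in Ω, q.fst x * ((partialDeriv i φ x : ℝ) : ℂ) := by
      refine Eq.trans (integral_congr_ae ?_)
        (integral_add ((Lp.memLp p.fst).integrable_mul (hφ.memLp_partialDeriv i _))
          ((Lp.memLp q.fst).integrable_mul (hφ.memLp_partialDeriv i _)))
      filter_upwards [Lp.coeFn_add p.fst q.fst] with x hx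
      simp only [hx, Pi.add_apply, add_mul]
    have h2 : ∫ x in Ω, ((p.snd + q.snd : L2Vec Ω) x) i * (φ x : ℂ)
        = (∫ x in Ω, (p.snd x) i * (φ x : ℂ)) + ∫ x in Ω, (q.snd x) i * (φ x : ℂ) := by
      refine Eq.trans (integral_congr_ae ?_)
        (integral_add ((memLp_coord p.snd i).integrable_mul (hφ.memLp _))
          ((memLp_coord q.snd i).integrable_mul (hφ.memLp _)))
      filter_upwards [Lp.coeFn_add p.snd q.snd] with x hx
      simp only [hx, Pi.add_apply, PiLp.add_apply, add_mul]
    exact h1.trans (by rw [hp φ hφ i, hq φ hφ i, WithLp.add_snd, h2, neg_add])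
  smul_mem' := by
    intro c p hp φ hφ i
    have h1 : ∫ x in Ω, ((c • p.fst : L2 Ω) x) * ((partialDeriv i φ x : ℝ) : ℂ)
        = c * ∫ x in Ω, p.fst x * ((partialDeriv i φ x : ℝ) : ℂ) := by
      rw [← integral_const_mul]
      refine integral_congr_ae ?_
      filter_upwards [Lp.coeFn_smul c p.fst] with x hx
      simp only [hx, Pi.smul_apply, smul_eq_mul, mul_assoc]
    have h2 : ∫ x in Ω, ((c • p.snd : L2Vec Ω) x) i * (φ x : ℂ)
        = c * ∫ x in Ω, (p.snd x) i * (φ x : ℂ) := by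
      rw [← integral_const_mul]
      refine integral_congr_ae ?_
      filter_upwards [Lp.coeFn_smul c p.snd] with x hx
      simp only [hx, Pi.smul_apply, PiLp.smul_apply, smul_eq_mul, mul_assoc]
    exact h1.trans (by rw [hp φ hφ i, WithLp.smul_snd, h2, mul_neg])

variable {Ω : Set R3}

/-- An `H¹` function as an element of `L²(Ω)`. -/
def toL2 (u : H1 Ω) : L2 Ω := u.val.fst

/-- The weak gradient of an `H¹` function. -/
def grad (u : H1 Ω) : L2Vec Ω := u.val.snd

/-- `g ∈ L²(Γ)` is a trace of `u ∈ H¹(Ω)`: there are functions, smooth on all of `ℝ³`, that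
converge to `u` in `H¹(Ω)` and whose restrictions to `Γ` converge to `g` in `L²(Γ)`. -/
def IsTrace (u : H1 Ω) (g : L2Bdry Ω) : Prop :=
  ∃ φ : ℕ → R3 → ℂ, (∀ n, ContDiff ℝ ∞ (φ n)) ∧
    Tendsto (fun n => eLpNorm (fun x => φ n x - toL2 u x) 2 (volume.restrict Ω)) atTop (𝓝 0) ∧
    Tendsto (fun n => eLpNorm (fun x => classicalGrad (φ n) x - grad u x) 2
      (volume.restrict Ω)) atTop (𝓝 0) ∧
    Tendsto (fun n => eLpNorm (fun x => φ n x - g x) 2 (surfaceMeasure Ω)) atTop (𝓝 0)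

open Classical in
/-- The trace operator `γ₀`, with values in `L²(Γ)`. -/
def trace (u : H1 Ω) : L2Bdry Ω :=
  if h : ∃ g : L2Bdry Ω, IsTrace u g then h.choose else 0

/-- The weighted norm `‖u‖_ρ = (‖∇u‖² + ρ²‖u‖²)^{1/2}`. -/
def wnorm (ρ : ℝ) (u : H1 Ω) : ℝ :=
  Real.sqrt (‖grad u‖ ^ 2 + ρ ^ 2 * ‖toL2 u‖ ^ 2)

/-- `a_{0,ζ}(u,v) = (∇u,∇v) + (ζ²u,v)`. Here `(·,·)` is conjugate-linear in the second argument,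
whereas `inner` is conjugate-linear in the first one. -/
def formA0 (ζ : ℂ) (u v : H1 Ω) : ℂ :=
  inner ℂ (grad v) (grad u) + inner ℂ (toL2 v) (ζ ^ 2 • toL2 u)

/-- `b_ζ(γ₀u,γ₀v) = (ζγ₀u,γ₀v)_Γ`. -/
def formB (ζ : ℂ) (u v : H1 Ω) : ℂ :=
  inner ℂ (trace v) (ζ • trace u)

/-- `a_ζ(u,v) = a_{0,ζ}(u,v) + b_ζ(γ₀u,γ₀v)`. -/
def formA (ζ : ℂ) (u v : H1 Ω) : ℂ :=
  formA0 ζ u v + formB ζ u v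

/-- `C` bounds the form `b_ζ` uniformly in `ζ` with `Re ζ ≥ 0`, `|ζ| ≥ 1`. -/
def IsRobinConstant (Ω : Set R3) (C : ℝ) : Prop :=
  ∀ ζ : ℂ, 0 ≤ ζ.re → 1 ≤ ‖ζ‖ → ∀ u v : H1 Ω,
    ‖formB ζ u v‖ ≤ C * wnorm ‖ζ‖ u * wnorm ‖ζ‖ v

/-- `1 + C` is a continuity constant of `a_ζ`, uniformly in `ζ` with `Re ζ ≥ 0`, `|ζ| ≥ 1`. -/
def IsContinuityConstant (Ω : Set R3) (C : ℝ) : Prop :=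
  ∀ ζ : ℂ, 0 ≤ ζ.re → 1 ≤ ‖ζ‖ → ∀ u v : H1 Ω,
    ‖formA ζ u v‖ ≤ (1 + C) * wnorm ‖ζ‖ u * wnorm ‖ζ‖ v

/-- `uS` is a Galerkin approximation in `S` of `u`. -/
def IsGalerkin (ζ : ℂ) (S : Submodule ℂ (H1 Ω)) (u uS : H1 Ω) : Prop :=
  uS ∈ S ∧ ∀ v ∈ S, formA ζ (u - uS) v = 0

/-- `z` solves the adjoint problem with right-hand side `f ∈ L²(Ω)`, that is,
`a_{ζ̄}(z,w) = (f,w)` for all `w ∈ H¹(Ω)`. -/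
def IsAdjointSolution (ζ : ℂ) (f : L2 Ω) (z : H1 Ω) : Prop :=
  ∀ w : H1 Ω, formA (starRingEnd ℂ ζ) z w = inner ℂ (toL2 w) f

/-- The numbers `inf_{v ∈ S} ‖z - v‖_{|ζ|} / ‖f‖` for `f ∈ L²(Ω) \ {0}`, where `z` solves the
adjoint problem with right-hand side `f`. -/
def adjointRatios (ζ : ℂ) (S : Submodule ℂ (H1 Ω)) : Set ℝ :=
  {r | ∃ (f : L2 Ω) (z : H1 Ω), f ≠ 0 ∧ IsAdjointSolution ζ f z ∧
    r = ⨅ v : S, wnorm ‖ζ‖ (z - (v : H1 Ω)) / ‖f‖}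

/-- The adjoint approximability `η(S)`. -/
def eta (ζ : ℂ) (S : Submodule ℂ (H1 Ω)) : ℝ :=
  sSup (adjointRatios ζ S)

end LossyHelmholtz

end

open MeasureTheory Filter Topology
open scoped ContDiff ENNReal

/-! The form becomes coercive after a rotation: Re(ζ̄ a_ζ(u,u)) = Re ζ (‖∇u‖² + |ζ|²‖u‖²) +
|ζ|²‖γ₀u‖², hence |a_ζ(u,u)| ≥ (Re ζ/|ζ|)‖u‖²_{|ζ|} (`re_div_norm_mul_wnorm_sq_le`). Lax–Milgram on
closed subspaces then yields the Galerkin and adjoint solutions. Galerkin orthogonality gives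
quasi-optimality (Céa), and the adjoint solution z with the error e as datum satisfies |a_ζ(e,z)| =
‖e‖², which gives the L² bound (Aubin–Nitsche).

The analytic work lies in the trace. The inequality t‖φ‖²_Γ ≤ C(t²‖φ‖² + ‖∇φ‖²) for smooth φ and t ≥
1 (`exists_lintegral_surfaceMeasure_le`) comes from integrating along rays from a star centre x₀.
The gauge of Ω - x₀ is Lipschitz because a whole ball of centres is available, so radial projection
maps the faces of a cube to Γ by Lipschitz maps whose images cover Γ, and Hausdorff measure on Γ is
controlled by Lebesgue measure on the faces. Taking t = |ζ| makes `C_b` independent of ζ.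

Smooth functions are dense in H¹(Ω) (`exists_contDiff_tendsto`): average u over the points ax +
(1-a)y with y near x₀. These points stay in Ω, and averaging commutes with ∇ up to the factor a.
Existence, uniqueness, linearity and boundedness of the trace then follow by taking the closure of
the space of triples (φ, ∇φ, φ|_Γ). -/

namespace LossyHelmholtz

/-! ### Lipschitz continuity of the gauge and of the radial projection. -/

section Gauge

variable {E : Type*} [NormedAddCommGroup E] [NormedSpace ℝ E]

/-- The star-shapedness of `K` with respect to the ball of radius `r` centred at the origin. -/
structure IsStarShapedAtZero (K : Set E) (r : ℝ) : Prop where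
  pos : 0 < r
  ball_subset : Metric.ball 0 r ⊆ K
  starConvex : ∀ y ∈ Metric.ball (0 : E) r, StarConvex ℝ y K

namespace IsStarShapedAtZero

variable {K : Set E} {r : ℝ}

lemma mem_nhds (h : IsStarShapedAtZero K r) : K ∈ 𝓝 (0 : E) :=
  Filter.mem_of_superset (Metric.ball_mem_nhds 0 h.pos) h.ball_subset

lemma absorbent (h : IsStarShapedAtZero K r) : Absorbent ℝ K :=
  absorbent_nhds_zero h.mem_nhds

lemma starConvex_zero (h : IsStarShapedAtZero K r) : StarConvex ℝ 0 K :=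
  h.starConvex 0 (Metric.mem_ball_self h.pos)

lemma mem_of_gauge_lt_one (h : IsStarShapedAtZero K r) {x : E} (hx : gauge K x < 1) : x ∈ K := by
  by_contra hn
  exact absurd (one_le_gauge_of_notMem h.starConvex_zero (h.absorbent x) hn) (not_le.2 hx)

/-- Half of subadditivity survives without convexity. Write `x = l • x'` with `x'` in `K` and `y = m
• y'` with `y'` in the ball of centres: then `x + y` is `l + m` times a convex combination of `x'`
and `y'`, which lies in `K` because `y'` is a centre. -/
lemma gauge_add_le (h : IsStarShapedAtZero K r) (x y : E) :
    gauge K (x + y) ≤ gauge K x + ‖y‖ / r := by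
  have hr := h.pos
  refine le_of_forall_pos_le_add fun ε hε => ?_
  obtain ⟨l, hl, hlx, hxl⟩ := exists_lt_of_gauge_lt h.absorbent
    (show gauge K x < gauge K x + ε / 2 by linarith)
  obtain ⟨x', hx', rfl⟩ := hxl
  set m : ℝ := ‖y‖ / r + ε / 2 with hm
  have hm0 : 0 < m := by positivity
  have hy : m⁻¹ • y ∈ Metric.ball (0 : E) r := by
    rw [mem_ball_zero_iff, norm_smul, norm_inv, Real.norm_of_nonneg hm0.le, inv_mul_lt_iff₀ hm0, hm,
      add_mul, div_mul_cancel₀ _ hr.ne']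
    nlinarith
  have hmem : (m / (l + m)) • (m⁻¹ • y) + (l / (l + m)) • x' ∈ K :=
    h.starConvex _ hy hx' (by positivity) (by positivity) (by field_simp; ring)
  have : gauge K (l • x' + y) ≤ l + m := by
    refine gauge_le_of_mem (by positivity) ⟨_, hmem, ?_⟩
    simp only [smul_add, smul_smul]
    rw [add_comm]
    congr 1
    · congr 1; field_simp
    · rw [show (l + m) * (m / (l + m) * m⁻¹) = 1 by field_simp, one_smul]
  simp only at hlx ⊢
  linarith

lemma gauge_sub_le (h : IsStarShapedAtZero K r) (x y : E) :
    gauge K x - gauge K y ≤ ‖x - y‖ / r := by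
  have := h.gauge_add_le y (x - y)
  rw [add_sub_cancel] at this
  linarith

lemma abs_gauge_sub_le (h : IsStarShapedAtZero K r) (x y : E) :
    |gauge K x - gauge K y| ≤ ‖x - y‖ / r := by
  refine abs_le.2 ⟨?_, h.gauge_sub_le x y⟩
  have := h.gauge_sub_le y x
  rw [norm_sub_rev] at this
  linarith

lemma continuous_gauge (h : IsStarShapedAtZero K r) : Continuous (gauge K) := by
  have hr := h.pos
  refine (LipschitzWith.of_dist_le_mul (K := (1 / r).toNNReal) fun x y => ?_).continuous
  rw [Real.dist_eq, dist_eq_norm, Real.coe_toNNReal _ (by positivity), one_div_mul_eq_div]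
  exact h.abs_gauge_sub_le x y

lemma gauge_le (h : IsStarShapedAtZero K r) (x : E) : gauge K x ≤ ‖x‖ / r := by
  have := h.gauge_add_le 0 x
  rwa [zero_add, gauge_zero, zero_add] at this

lemma norm_div_le_gauge (h : IsStarShapedAtZero K r) {R : ℝ} (hR : 0 < R)
    (hK : K ⊆ Metric.ball 0 R) (x : E) : ‖x‖ / R ≤ gauge K x := by
  rw [← gauge_ball hR.le]
  exact gauge_mono h.absorbent hK x

lemma gauge_eq_one_of_mem_frontier (h : IsStarShapedAtZero K r) (hK : IsOpen K) {x : E}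
    (hx : x ∈ frontier K) : gauge K x = 1 := by
  refine le_antisymm ?_ ?_
  · have hc : closure K ⊆ {x | gauge K x ≤ 1} :=
      closure_minimal (fun y hy => gauge_le_one_of_mem hy)
        (isClosed_le h.continuous_gauge continuous_const)
    exact hc hx.1
  · refine one_le_gauge_of_notMem h.starConvex_zero (h.absorbent x) ?_
    have := hx.2
    rwa [hK.interior_eq] at this

/-- The radial projection onto the boundary. -/
noncomputable def _root_.LossyHelmholtz.radialProj (K : Set E) (x : E) : E := (gauge K x)⁻¹ • x

lemma lipschitzOnWith_radialProj (h : IsStarShapedAtZero K r) {R : ℝ} (hR : 0 < R)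
    (hK : K ⊆ Metric.ball 0 R) :
    LipschitzOnWith (R + R * R / r).toNNReal (radialProj K) {x | 1 ≤ ‖x‖} := by
  have hr := h.pos
  refine LipschitzOnWith.of_dist_le_mul fun x hx y hy => ?_
  rw [Real.coe_toNNReal _ (by positivity), dist_eq_norm, dist_eq_norm]
  have hx1 : 1 ≤ ‖x‖ := hx
  have hy1 : 1 ≤ ‖y‖ := hy
  have hpx := h.norm_div_le_gauge hR hK x
  have hpy := h.norm_div_le_gauge hR hK y
  have hpx0 : 0 < gauge K x := lt_of_lt_of_le (by positivity) hpx
  have hpy0 : 0 < gauge K y := lt_of_lt_of_le (by positivity) hpy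
  have hix : (gauge K x)⁻¹ ≤ R := by
    rw [inv_le_comm₀ hpx0 hR]
    refine le_trans ?_ hpx
    rw [inv_eq_one_div]; gcongr
  have hiy : ‖y‖ * (gauge K y)⁻¹ ≤ R := by
    rw [← div_eq_mul_inv, div_le_iff₀ hpy0]
    rwa [div_le_iff₀' hR] at hpy
  -- The difference splits into a change of direction, contributing `R`, and a change of length
  -- controlled by the Lipschitz bound of the gauge, contributing `R * R / r`.
  have key : radialProj K x - radialProj K y = (gauge K x)⁻¹ • (x - y) +
      ((gauge K x)⁻¹ * (gauge K y)⁻¹ * (gauge K y - gauge K x)) • y := by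
    simp only [radialProj]
    rw [show (gauge K x)⁻¹ * (gauge K y)⁻¹ * (gauge K y - gauge K x)
      = (gauge K x)⁻¹ - (gauge K y)⁻¹ by field_simp, smul_sub, sub_smul]
    abel
  have hd : |gauge K y - gauge K x| ≤ ‖x - y‖ / r := by
    rw [abs_sub_comm]; exact h.abs_gauge_sub_le x y
  rw [key]
  refine (norm_add_le _ _).trans ?_
  rw [norm_smul, norm_smul, norm_mul, norm_mul, norm_inv, norm_inv, Real.norm_eq_abs,
    Real.norm_eq_abs, Real.norm_eq_abs, abs_of_pos hpx0, abs_of_pos hpy0, add_mul]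
  refine add_le_add (by gcongr) ?_
  calc (gauge K x)⁻¹ * (gauge K y)⁻¹ * |gauge K y - gauge K x| * ‖y‖
      = (gauge K x)⁻¹ * (‖y‖ * (gauge K y)⁻¹) * |gauge K y - gauge K x| := by ring
    _ ≤ R * R * (‖x - y‖ / r) := by gcongr
    _ = R * R / r * ‖x - y‖ := by ring

lemma radialProj_smul_of_gauge_eq_one {x : E} (hx : gauge K x = 1) {c : ℝ} (hc : 0 < c) :
    radialProj K (c • x) = x := by
  simp only [radialProj]
  rw [gauge_smul_of_nonneg hc.le, hx, smul_smul, smul_eq_mul, mul_one, inv_mul_cancel₀ hc.ne',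
    one_smul]

end IsStarShapedAtZero

end Gauge

/-! ### One-dimensional trace estimate. -/

section RayEstimate

/-- A weighted trace estimate at the end point of an interval. -/
lemma pow_three_mul_norm_sq_le {f f' : ℝ → ℂ} (hf : ∀ s, HasDerivAt f (f' s) s)
    (hf' : Continuous f') {R t : ℝ} (hR : 0 ≤ R) (ht : 1 ≤ t) :
    t * (R ^ 3 * ‖f R‖ ^ 2) ≤
      ∫ s in (0 : ℝ)..R, s ^ 2 * (3 * (t ^ 2 * ‖f s‖ ^ 2) + s * (t ^ 2 * ‖f s‖ ^ 2 + ‖f' s‖ ^ 2)) := by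
  have hfc : Continuous f := continuous_iff_continuousAt.2 fun s => (hf s).continuousAt
  -- The weight `s ^ 3` removes the end point 0, and its derivative keeps a factor `s ^ 2`, the
  -- Jacobian of the cone coordinates used later.
  have hd : ∀ s, HasDerivAt (fun s : ℝ => t * (s ^ 3 * ‖f s‖ ^ 2))
      (t * (3 * s ^ 2 * ‖f s‖ ^ 2 + s ^ 3 * (2 * inner ℝ (f s) (f' s)))) s := by
    intro s
    have h1 := (hf s).norm_sq
    have h2 : HasDerivAt (fun s : ℝ => s ^ 3) (3 * s ^ 2) s := by simpa using hasDerivAt_pow 3 s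
    exact (h2.mul h1).const_mul t
  have hci : Continuous fun s => t * (3 * s ^ 2 * ‖f s‖ ^ 2 + s ^ 3 * (2 * inner ℝ (f s) (f' s))) := by
    have : Continuous fun s => (inner ℝ (f s) (f' s) : ℝ) := hfc.inner hf'
    fun_prop
  have hftc := intervalIntegral.integral_eq_sub_of_hasDerivAt (a := 0) (b := R)
    (fun s _ => hd s) (hci.intervalIntegrable _ _)
  have h0 : t * (R ^ 3 * ‖f R‖ ^ 2) = ∫ s in (0 : ℝ)..R,
      t * (3 * s ^ 2 * ‖f s‖ ^ 2 + s ^ 3 * (2 * inner ℝ (f s) (f' s))) := by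
    rw [hftc]; simp
  rw [h0]
  refine intervalIntegral.integral_mono_on hR (hci.intervalIntegrable _ _) ?_ ?_
  · exact Continuous.intervalIntegrable (by fun_prop) _ _
  · intro s hs
    have hin : (inner ℝ (f s) (f' s) : ℝ) ≤ ‖f s‖ * ‖f' s‖ := real_inner_le_norm _ _
    have hy : 2 * t * (inner ℝ (f s) (f' s) : ℝ) ≤ t ^ 2 * ‖f s‖ ^ 2 + ‖f' s‖ ^ 2 := by
      nlinarith [sq_nonneg (t * ‖f s‖ - ‖f' s‖)]
    have ht2 : t ≤ t ^ 2 := by nlinarith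
    have e1 : t * (3 * s ^ 2 * ‖f s‖ ^ 2) ≤ s ^ 2 * (3 * (t ^ 2 * ‖f s‖ ^ 2)) := by
      have : t * (3 * s ^ 2 * ‖f s‖ ^ 2) ≤ t ^ 2 * (3 * s ^ 2 * ‖f s‖ ^ 2) := by gcongr
      linarith
    have e2 := mul_le_mul_of_nonneg_left hy (pow_nonneg hs.1 3)
    nlinarith

end RayEstimate

/-! ### Cone coordinates over the faces of a cube. -/

section Faces

/-- The parametrisation of the plane `{x i = 1}`. -/
def faceMap (i : Fin 3) (y : Fin 2 → ℝ) : R3 :=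
  WithLp.toLp 2 (i.insertNth (α := fun _ => ℝ) 1 y)

/-- Cone coordinates replace polar ones: at height `s` the face is scaled by `s` in two directions,
whence the Jacobian `s ^ 2`. -/
lemma smul_faceMap (i : Fin 3) (s : ℝ) (y : Fin 2 → ℝ) :
    s • faceMap i y = WithLp.toLp 2 (i.insertNth (α := fun _ => ℝ) s (s • y)) := by
  ext j
  refine Fin.succAboveCases i ?_ (fun k => ?_) j <;> simp [faceMap]

lemma measurable_faceMap (i : Fin 3) : Measurable (faceMap i) := by
  refine (WithLp.measurable_toLp 2 (Fin 3 → ℝ)).comp ?_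
  exact (MeasurableEquiv.piFinSuccAbove (fun _ : Fin 3 => ℝ) i).symm.measurable.comp
    (measurable_const.prodMk measurable_id)

/-- The parameters carry the sup norm; passing to the Euclidean norm of three coordinates costs √3 ≤
2. -/
lemma lipschitzWith_faceMap (i : Fin 3) : LipschitzWith 2 (faceMap i) := by
  have h1 : LipschitzWith 1 fun y : Fin 2 → ℝ => (i.insertNth (α := fun _ => ℝ) 1 y) := by
    refine LipschitzWith.mk_one fun x y => ?_
    refine (dist_pi_le_iff dist_nonneg).2 fun j => ?_
    refine Fin.succAboveCases i ?_ (fun k => ?_) j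
    · simp
    · simpa using dist_le_pi_dist x y k
  have h2 := (PiLp.lipschitzWith_toLp 2 (fun _ : Fin 3 => ℝ)).comp h1
  refine h2.weaken ?_
  rw [mul_one, ← NNReal.coe_le_coe]
  simp only [Fintype.card_fin, NNReal.coe_rpow]
  norm_num
  rw [← Real.sqrt_eq_rpow, Real.sqrt_le_left (by norm_num)]
  norm_num

lemma one_le_norm_faceMap (i : Fin 3) (y : Fin 2 → ℝ) : 1 ≤ ‖faceMap i y‖ := by
  have := PiLp.norm_apply_le (faceMap i y) i
  simpa [faceMap] using this

lemma norm_faceMap_le (i : Fin 3) {y : Fin 2 → ℝ} (hy : y ∈ Set.Icc (-1) 1) :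
    ‖faceMap i y‖ ≤ 2 := by
  rw [EuclideanSpace.norm_eq, Real.sqrt_le_left (by norm_num), Fin.sum_univ_succAbove _ i]
  have h : ∀ k, y k ^ 2 ≤ 1 := fun k => by
    have h1 := hy.1 k
    have h2 := hy.2 k
    simp only [Pi.neg_apply, Pi.one_apply] at h1 h2
    nlinarith
  have := h 0
  have := h 1
  simp [faceMap, Fin.sum_univ_two]
  linarith

/-- Every nonzero vector is a positive multiple of a point on a face of the cube. -/
lemma exists_smul_faceMap {x : R3} (hx : x ≠ 0) :
    ∃ (i : Fin 3) (σ : Bool) (c : ℝ) (y : Fin 2 → ℝ), 0 < c ∧ y ∈ Set.Icc (-1) 1 ∧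
      (cond σ 1 (-1) : ℝ) • faceMap i y = c • x := by
  -- The face is chosen by the coordinate of largest modulus: dividing by it puts the others in
  -- `[-1, 1]`, and its sign selects `σ`.
  obtain ⟨i, hi⟩ := Finite.exists_max fun i => |x i|
  have hxi : 0 < |x i| := by
    by_contra! h
    refine hx (PiLp.ext fun j => ?_)
    have := (hi j).trans h
    simpa using this
  have main : ∀ (σ : Bool), (cond σ 1 (-1) : ℝ) * |x i| = x i →
      ∃ (i : Fin 3) (σ : Bool) (c : ℝ) (y : Fin 2 → ℝ), 0 < c ∧ y ∈ Set.Icc (-1) 1 ∧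
      (cond σ 1 (-1) : ℝ) • faceMap i y = c • x := by
    intro σ hσ
    have hb : ∀ j, |x j / x i| ≤ 1 := fun j => by
      rw [abs_div]; exact div_le_one_of_le₀ (hi j) (abs_nonneg _)
    refine ⟨i, σ, |x i|⁻¹, fun k => x (i.succAbove k) / x i, by positivity,
      ⟨fun k => (abs_le.1 (hb _)).1, fun k => (abs_le.1 (hb _)).2⟩, ?_⟩
    ext j
    refine Fin.succAboveCases i ?_ (fun k => ?_) j
    · simp only [faceMap, PiLp.smul_apply, Fin.insertNth_apply_same, smul_eq_mul, mul_one]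
      rw [eq_inv_mul_iff_mul_eq₀ hxi.ne', mul_comm]; exact hσ
    · simp only [faceMap, PiLp.smul_apply, Fin.insertNth_apply_succAbove, smul_eq_mul]
      have h0 : x i ≠ 0 := abs_pos.1 hxi
      rw [mul_div_assoc', div_eq_iff h0]
      nth_rw 2 [← hσ]
      field_simp
  rcases le_total 0 (x i) with h | h
  · exact main true (by simp [abs_of_nonneg h])
  · exact main false (by simp [abs_of_nonpos h])

lemma lintegral_comp_smul_pi {s : ℝ} (hs : 0 < s) (H : (Fin 2 → ℝ) → ℝ≥0∞) (hH : Measurable H) :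
    ∫⁻ y, ENNReal.ofReal (s ^ 2) * H (s • y) = ∫⁻ y, H y := by
  have h1 : ∫⁻ y, H (s • y) = ∫⁻ y, H y ∂(Measure.map (s • ·) volume) :=
    (lintegral_map hH (measurable_const_smul s)).symm
  rw [lintegral_const_mul _ (show Measurable fun y => H (s • y) from
      hH.comp (measurable_const_smul s)), h1,
    Measure.map_addHaar_smul volume hs.ne', lintegral_smul_measure, smul_eq_mul, ← mul_assoc,
    ← ENNReal.ofReal_mul (by positivity)]
  rw [Module.finrank_fin_fun, abs_of_pos (by positivity), mul_inv_cancel₀ (by positivity)]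
  simp

/-- Integration over the cone spanned by a face of the cube. -/
lemma lintegral_cone_le (i : Fin 3) {G : R3 → ℝ≥0∞} (hG : Measurable G) :
    ∫⁻ y, ∫⁻ s in Set.Ioi (0 : ℝ), ENNReal.ofReal (s ^ 2) * G (s • faceMap i y) ≤ ∫⁻ x, G x := by
  have hm : Measurable fun q : ℝ × (Fin 2 → ℝ) =>
      G (WithLp.toLp 2 (i.insertNth (α := fun _ => ℝ) q.1 q.2)) :=
    hG.comp ((WithLp.measurable_toLp 2 (Fin 3 → ℝ)).comp
      (MeasurableEquiv.piFinSuccAbove (fun _ : Fin 3 => ℝ) i).symm.measurable)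
  rw [lintegral_lintegral_swap]
  · calc ∫⁻ s in Set.Ioi (0 : ℝ), ∫⁻ y, ENNReal.ofReal (s ^ 2) * G (s • faceMap i y)
        = ∫⁻ s in Set.Ioi (0 : ℝ), ∫⁻ y, G (WithLp.toLp 2 (i.insertNth (α := fun _ => ℝ) s y)) := by
          refine setLIntegral_congr_fun measurableSet_Ioi fun s hs => ?_
          simp only [smul_faceMap]
          exact lintegral_comp_smul_pi hs
            (fun y => G (WithLp.toLp 2 (i.insertNth (α := fun _ => ℝ) s y)))
            (hm.comp (measurable_const.prodMk measurable_id))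
      _ ≤ ∫⁻ s, ∫⁻ y, G (WithLp.toLp 2 (i.insertNth (α := fun _ => ℝ) s y)) :=
          setLIntegral_le_lintegral _ _
      _ = ∫⁻ q : ℝ × (Fin 2 → ℝ), G (WithLp.toLp 2 (i.insertNth (α := fun _ => ℝ) q.1 q.2)) :=
          (lintegral_prod _ hm.aemeasurable).symm
      _ = ∫⁻ z : Fin 3 → ℝ, G (WithLp.toLp 2 z) :=
          ((volume_preserving_piFinSuccAbove (fun _ : Fin 3 => ℝ) i).symm _).lintegral_comp
            (hG.comp (WithLp.measurable_toLp 2 (Fin 3 → ℝ)))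
      _ = ∫⁻ x, G x := (PiLp.volume_preserving_toLp (Fin 3)).lintegral_comp hG
  · refine Measurable.aemeasurable ?_
    refine Measurable.mul (by fun_prop) (hG.comp ?_)
    exact measurable_snd.smul ((measurable_faceMap i).comp measurable_fst)

end Faces

/-! ### Hausdorff measure of Lipschitz images. -/

section Hausdorff

/-- Integrals over Lipschitz images with respect to the two-dimensional Hausdorff measure. -/
lemma lintegral_hausdorffMeasure_image_le {X : Type*} [MetricSpace X] [MeasurableSpace X]
    [BorelSpace X] {K : NNReal} {ψ : (Fin 2 → ℝ) → X} {s : Set (Fin 2 → ℝ)} (hs : MeasurableSet s)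
    (hψ : LipschitzOnWith K ψ s) {h : X → ℝ≥0∞} (hh : Measurable h) :
    ∫⁻ x in ψ '' s, h x ∂(Measure.hausdorffMeasure 2) ≤ (K : ℝ≥0∞) ^ 2 * ∫⁻ y in s, h (ψ y) := by
  have hψm : AEMeasurable ψ (volume.restrict s) := hψ.continuousOn.aemeasurable hs
  have hle : (Measure.hausdorffMeasure 2 : Measure X).restrict (ψ '' s) ≤
      (K : ℝ≥0∞) ^ 2 • Measure.map ψ (volume.restrict s) := by
    refine Measure.le_iff.2 fun A hA => ?_
    rw [Measure.restrict_apply hA, Measure.smul_apply, smul_eq_mul,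
      Measure.map_apply_of_aemeasurable hψm hA]
    have h1 : A ∩ ψ '' s = ψ '' (ψ ⁻¹' A ∩ s) := by
      rw [Set.image_preimage_inter]
    have h2 := (hψ.mono Set.inter_subset_right :
      LipschitzOnWith K ψ (ψ ⁻¹' A ∩ s)).hausdorffMeasure_image_le
      (d := 2) (by norm_num)
    -- For the sup metric on `Fin 2 → ℝ`, Hausdorff measure is Lebesgue measure without any
    -- normalising factor.
    have h3 : (Measure.hausdorffMeasure 2 : Measure (Fin 2 → ℝ)) = volume := by
      have := hausdorffMeasure_pi_real (ι := Fin 2)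
      simpa using this
    rw [h1]
    refine h2.trans ?_
    rw [h3]
    have h4 : (K : ℝ≥0∞) ^ (2 : ℝ) = (K : ℝ≥0∞) ^ 2 := by
      exact_mod_cast ENNReal.rpow_natCast (K : ℝ≥0∞) 2
    rw [h4]
    exact mul_le_mul' le_rfl (Measure.le_restrict_apply _ _)
  refine (lintegral_mono' hle le_rfl).trans ?_
  rw [lintegral_smul_measure, smul_eq_mul, lintegral_map' hh.aemeasurable hψm]

end Hausdorff

/-! ### Directional derivatives and the complex gradient. -/

section Gradient

/-- The derivative along a real vector `e` is the Hermitian product of `e` with the complex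
gradient, so Cauchy–Schwarz applies. -/
lemma norm_fderiv_apply_le (φ : R3 → ℂ) (x e : R3) :
    ‖fderiv ℝ φ x e‖ ≤ ‖e‖ * ‖classicalGrad φ x‖ := by
  have he : e = ∑ i, e i • EuclideanSpace.single i (1 : ℝ) := by
    ext j
    simp [Finset.sum_apply, Pi.single_apply]
  have h1 : fderiv ℝ φ x e = ∑ i, (e i : ℂ) * partialDeriv i φ x := by
    conv_lhs => rw [he]
    simp [map_sum, partialDeriv]
  have h2 : fderiv ℝ φ x e =
      inner ℂ (WithLp.toLp 2 fun i => (e i : ℂ) : C3) (classicalGrad φ x) := by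
    rw [h1, PiLp.inner_apply]
    refine Finset.sum_congr rfl fun i _ => ?_
    simp [classicalGrad, mul_comm]
  have h3 : ‖(WithLp.toLp 2 fun i => (e i : ℂ) : C3)‖ = ‖e‖ := by
    simp [EuclideanSpace.norm_eq]
  rw [h2, ← h3]
  exact norm_inner_le_norm _ _

lemma continuous_classicalGrad {φ : R3 → ℂ} (hφ : ContDiff ℝ ∞ φ) :
    Continuous (classicalGrad φ) := by
  refine (PiLp.continuous_toLp 2 _).comp (continuous_pi fun i => ?_)
  exact (hφ.continuous_fderiv (by simp)).clm_apply continuous_const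

end Gradient

/-! ### The weighted trace inequality for smooth functions. -/

section TraceInequality

/-- Trace estimate along a single ray. -/
lemma ray_estimate {K : Set R3} {r R : ℝ} (h : IsStarShapedAtZero K r) (hR : 0 < R)
    (hK : K ⊆ Metric.ball 0 R) (x₀ : R3) {φ : R3 → ℂ} (hφ : ContDiff ℝ ∞ φ) {t : ℝ} (ht : 1 ≤ t)
    {e : R3} (he1 : 1 ≤ ‖e‖) (he2 : ‖e‖ ≤ 2) :
    ENNReal.ofReal (t * ‖φ (x₀ + radialProj K e)‖ ^ 2) ≤
      ENNReal.ofReal (8 / r ^ 3 * (3 + 4 * R)) * ∫⁻ s in Set.Ioi (0 : ℝ), ENNReal.ofReal (s ^ 2) *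
        K.indicator (fun x => ENNReal.ofReal
          (t ^ 2 * ‖φ (x₀ + x)‖ ^ 2 + ‖classicalGrad φ (x₀ + x)‖ ^ 2)) (s • e) := by
  have hr := h.pos
  have hp0 : 0 < gauge K e := lt_of_lt_of_le (by positivity) (h.norm_div_le_gauge hR hK e)
  -- `Q • e` is the point where the ray leaves `K`; the bounds `1 ≤ ‖e‖ ≤ 2` place `Q` in `[r / 2,
  -- R]`.
  set Q : ℝ := (gauge K e)⁻¹ with hQ
  have hQ0 : 0 < Q := inv_pos.2 hp0
  have hQR : Q ≤ R := by
    rw [hQ, inv_le_comm₀ hp0 hR]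
    refine le_trans ?_ (h.norm_div_le_gauge hR hK e)
    rw [inv_eq_one_div]; gcongr
  have hQr : r / 2 ≤ Q := by
    rw [hQ, le_inv_comm₀ (by positivity) hp0, inv_div]
    exact (h.gauge_le e).trans (by gcongr)
  set g : ℝ → ℝ := fun s => t ^ 2 * ‖φ (x₀ + s • e)‖ ^ 2 + ‖classicalGrad φ (x₀ + s • e)‖ ^ 2 with hg
  have hgc : Continuous g := by
    have := continuous_classicalGrad hφ
    have := hφ.continuous
    fun_prop
  have hd : ∀ s, HasDerivAt (fun s : ℝ => φ (x₀ + s • e)) (fderiv ℝ φ (x₀ + s • e) e) s := by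
    intro s
    have h1 : HasDerivAt (fun s : ℝ => x₀ + s • e) e s := by
      simpa using ((hasDerivAt_id s).smul_const e).const_add x₀
    exact ((hφ.differentiable (by simp)) _).hasFDerivAt.comp_hasDerivAt s h1
  have hdc : Continuous fun s : ℝ => fderiv ℝ φ (x₀ + s • e) e :=
    ((hφ.continuous_fderiv (by simp)).comp (by fun_prop)).clm_apply continuous_const
  have hmain := pow_three_mul_norm_sq_le hd hdc hQ0.le ht
  -- In `3 + 4 * R` the 3 comes from differentiating `s ^ 3`, the `R` from `s ≤ R`, and the 4 from
  -- `‖e‖ ^ 2 ≤ 4`.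
  have hint : ∫ s in (0 : ℝ)..Q, s ^ 2 * (3 * (t ^ 2 * ‖φ (x₀ + s • e)‖ ^ 2) +
      s * (t ^ 2 * ‖φ (x₀ + s • e)‖ ^ 2 + ‖fderiv ℝ φ (x₀ + s • e) e‖ ^ 2)) ≤
      ∫ s in (0 : ℝ)..Q, (3 + 4 * R) * (s ^ 2 * g s) := by
    have := hφ.continuous
    refine intervalIntegral.integral_mono_on hQ0.le
      (Continuous.intervalIntegrable (by fun_prop) _ _)
      (Continuous.intervalIntegrable (by fun_prop) _ _) fun s hs => ?_
    have hs0 := hs.1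
    have hsR : s ≤ R := hs.2.trans hQR
    have h1 : ‖fderiv ℝ φ (x₀ + s • e) e‖ ^ 2 ≤ 4 * ‖classicalGrad φ (x₀ + s • e)‖ ^ 2 := by
      have h2 : ‖fderiv ℝ φ (x₀ + s • e) e‖ ≤ 2 * ‖classicalGrad φ (x₀ + s • e)‖ :=
        (norm_fderiv_apply_le φ _ e).trans (by gcongr)
      calc _ ≤ (2 * ‖classicalGrad φ (x₀ + s • e)‖) ^ 2 := by gcongr
        _ = _ := by ring
    simp only [hg]
    set a := t ^ 2 * ‖φ (x₀ + s • e)‖ ^ 2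
    set b := ‖classicalGrad φ (x₀ + s • e)‖ ^ 2
    have ha : 0 ≤ a := by positivity
    have hb : 0 ≤ b := by positivity
    have h3 : s * (a + ‖fderiv ℝ φ (x₀ + s • e) e‖ ^ 2) ≤ R * (a + 4 * b) := by gcongr
    calc _ ≤ s ^ 2 * (3 * a + R * (a + 4 * b)) := by gcongr
      _ ≤ s ^ 2 * ((3 + 4 * R) * (a + b)) := by
        gcongr
        nlinarith [mul_nonneg hR.le ha]
      _ = _ := by ring
  rw [intervalIntegral.integral_const_mul] at hint
  -- Since `Q ≥ r / 2`, dividing by `Q ^ 3` costs at most `8 / r ^ 3`.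
  have hlower : t * ‖φ (x₀ + Q • e)‖ ^ 2 ≤
      8 / r ^ 3 * (3 + 4 * R) * ∫ s in (0 : ℝ)..Q, s ^ 2 * g s := by
    have h1 : (r / 2) ^ 3 * (t * ‖φ (x₀ + Q • e)‖ ^ 2) ≤ t * (Q ^ 3 * ‖φ (x₀ + Q • e)‖ ^ 2) := by
      rw [← mul_left_comm]; gcongr
    have h2 := (h1.trans hmain).trans hint
    calc t * ‖φ (x₀ + Q • e)‖ ^ 2
        = 8 / r ^ 3 * ((r / 2) ^ 3 * (t * ‖φ (x₀ + Q • e)‖ ^ 2)) := by field_simp; ring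
      _ ≤ 8 / r ^ 3 * ((3 + 4 * R) * ∫ s in (0 : ℝ)..Q, s ^ 2 * g s) := by gcongr
      _ = _ := by ring
  have hgn : ∀ s, 0 ≤ s ^ 2 * g s := fun s => by positivity
  refine (ENNReal.ofReal_le_ofReal hlower).trans ?_
  rw [ENNReal.ofReal_mul (by positivity), intervalIntegral.integral_of_le hQ0.le,
    ← Measure.restrict_congr_set Ioo_ae_eq_Ioc,
    ofReal_integral_eq_lintegral_ofReal
      (((by fun_prop : Continuous fun s => s ^ 2 * g s).integrableOn_Icc).mono_set
        Set.Ioo_subset_Icc_self)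
      (Eventually.of_forall hgn)]
  refine mul_le_mul' le_rfl ?_
  refine le_trans (le_of_eq ?_) (lintegral_mono_set (Set.Ioo_subset_Ioi_self : Set.Ioo 0 Q ⊆ _))
  refine setLIntegral_congr_fun measurableSet_Ioo fun s hs => ?_
  have hmem : s • e ∈ K := by
    refine h.mem_of_gauge_lt_one ?_
    rw [gauge_smul_of_nonneg hs.1.le, smul_eq_mul]
    calc s * gauge K e < Q * gauge K e := by
          have := hs.2; gcongr
      _ = 1 := inv_mul_cancel₀ hp0.ne'
  simp only [Set.indicator_of_mem hmem]
  rw [ENNReal.ofReal_mul (by positivity)]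

variable {Ω : Set R3}

lemma preimage_add_isStarShapedAtZero {x₀ : R3} {ρ : ℝ} (hρ : 0 < ρ)
    (hb : Metric.ball x₀ ρ ⊆ Ω) (hs : ∀ y ∈ Metric.ball x₀ ρ, StarConvex ℝ y Ω) :
    IsStarShapedAtZero ((fun x => x₀ + x) ⁻¹' Ω) ρ := by
  refine ⟨hρ, fun y hy => hb ?_, fun y hy z hz a b ha hb' hab => ?_⟩
  · simpa [dist_eq_norm] using hy
  · have h1 : x₀ + y ∈ Metric.ball x₀ ρ := by simpa [dist_eq_norm] using hy
    have h2 := hs _ h1 hz ha hb' hab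
    have h3 : x₀ + (a • y + b • z) = a • (x₀ + y) + b • (x₀ + z) := by
      have : x₀ = (a + b) • x₀ := by rw [hab, one_smul]
      conv_lhs => rw [this]
      module
    rw [Set.mem_preimage, h3]
    exact h2

/-- The weighted trace inequality for smooth functions. -/
theorem exists_lintegral_surfaceMeasure_le (hΩ : IsAdmissibleDomain Ω) :
    ∃ C : ℝ, 0 ≤ C ∧ ∀ φ : R3 → ℂ, ContDiff ℝ ∞ φ → ∀ t : ℝ, 1 ≤ t →
      ∫⁻ x, ENNReal.ofReal (t * ‖φ x‖ ^ 2) ∂(surfaceMeasure Ω) ≤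
        ENNReal.ofReal C * ∫⁻ x in Ω,
          ENNReal.ofReal (t ^ 2 * ‖φ x‖ ^ 2 + ‖classicalGrad φ x‖ ^ 2) := by
  obtain ⟨x₀, r, hr, hball, hstar⟩ := hΩ.starShaped
  obtain ⟨R, hR, hΩR⟩ := hΩ.isBounded.subset_ball_lt 0 x₀
  set K : Set R3 := (fun x => x₀ + x) ⁻¹' Ω with hKdef
  have h : IsStarShapedAtZero K r := preimage_add_isStarShapedAtZero hr hball hstar
  have hK : K ⊆ Metric.ball 0 R := fun x hx => by simpa [dist_eq_norm] using hΩR hx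
  have hKo : IsOpen K := hΩ.isOpen.preimage (by fun_prop)
  obtain ⟨κ, hsurf⟩ : ∃ κ : NNReal, surfaceMeasure Ω =
      κ • (Measure.hausdorffMeasure ((2 : ℕ) : ℝ) : Measure R3).restrict (frontier Ω) :=
    ⟨_, by rw [surfaceMeasure, Measure.euclideanHausdorffMeasure_def, Measure.restrict_smul]⟩
  rw [Nat.cast_ofNat] at hsurf
  set L : NNReal := (R + R * R / r).toNNReal * 2 with hL
  let ψ : Fin 3 × Bool → (Fin 2 → ℝ) → R3 := fun p y =>
    x₀ + radialProj K ((cond p.2 1 (-1) : ℝ) • faceMap p.1 y)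
  have hnorm : ∀ (p : Fin 3 × Bool) y, ‖(cond p.2 1 (-1) : ℝ) • faceMap p.1 y‖ = ‖faceMap p.1 y‖ := by
    rintro ⟨i, _ | _⟩ y <;> simp
  have hψ : ∀ p, LipschitzOnWith L (ψ p) (Set.Icc (-1) 1) := by
    intro p
    have h1 : LipschitzWith 2 fun y => (cond p.2 1 (-1) : ℝ) • faceMap p.1 y := by
      obtain ⟨i, σ⟩ := p
      cases σ
      · refine LipschitzWith.of_dist_le_mul fun y z => ?_
        simpa using (lipschitzWith_faceMap i).dist_le_mul y z
      · simpa using lipschitzWith_faceMap i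
    have h2 := (h.lipschitzOnWith_radialProj hR hK).comp (h1.lipschitzOnWith (s := Set.Icc (-1) 1))
      (fun y _ => by
        change 1 ≤ ‖(cond p.2 1 (-1) : ℝ) • faceMap p.1 y‖
        rw [hnorm]; exact one_le_norm_faceMap _ _)
    intro y hy z hz
    simpa [ψ, hL] using h2 hy hz
  have hcover : frontier Ω ⊆ ⋃ p, ψ p '' Set.Icc (-1) 1 := by
    intro x hx
    have hx' : x - x₀ ∈ frontier K := by
      have := (Homeomorph.addLeft x₀).preimage_frontier Ω
      have h2 : x - x₀ ∈ (Homeomorph.addLeft x₀) ⁻¹' frontier Ω := by simpa using hx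
      rw [this] at h2
      exact h2
    have hg := h.gauge_eq_one_of_mem_frontier hKo hx'
    have hne : x - x₀ ≠ 0 := by
      intro h0; rw [h0, gauge_zero] at hg; exact zero_ne_one hg
    obtain ⟨i, σ, c, y, hc, hy, hcy⟩ := exists_smul_faceMap hne
    refine Set.mem_iUnion.2 ⟨(i, σ), y, hy, ?_⟩
    simp only [ψ, hcy]
    rw [IsStarShapedAtZero.radialProj_smul_of_gauge_eq_one hg hc]
    abel
  -- `κ` normalises the Hausdorff measure, 6 counts the faces, `L ^ 2` bounds the area distortion of
  -- `ψ`, and the last factor comes from `ray_estimate`.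
  refine ⟨κ * (6 * (L ^ 2 * (8 / r ^ 3 * (3 + 4 * R)))), by positivity, fun φ hφ t ht => ?_⟩
  have hgm := (continuous_classicalGrad hφ).measurable
  have hφm := hφ.continuous.measurable
  set G : R3 → ℝ≥0∞ := K.indicator (fun x => ENNReal.ofReal
          (t ^ 2 * ‖φ (x₀ + x)‖ ^ 2 + ‖classicalGrad φ (x₀ + x)‖ ^ 2)) with hG
  have hGm : Measurable G := by
    refine Measurable.indicator ?_ hKo.measurableSet
    have h1 : Measurable fun x => φ (x₀ + x) := hφm.comp (by fun_prop)
    have h2 : Measurable fun x => classicalGrad φ (x₀ + x) := hgm.comp (by fun_prop)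
    fun_prop
  have hGint : ∫⁻ x, G x = ∫⁻ x in Ω,
      ENNReal.ofReal (t ^ 2 * ‖φ x‖ ^ 2 + ‖classicalGrad φ x‖ ^ 2) := by
    rw [← lintegral_indicator hΩ.isOpen.measurableSet,
      ← lintegral_add_left_eq_self (Ω.indicator _) x₀]
    rfl
  have hface : ∀ p, ∫⁻ x in ψ p '' Set.Icc (-1) 1, ENNReal.ofReal (t * ‖φ x‖ ^ 2)
      ∂(Measure.hausdorffMeasure 2) ≤
      (L : ℝ≥0∞) ^ 2 * (ENNReal.ofReal (8 / r ^ 3 * (3 + 4 * R)) * ∫⁻ x, G x) := by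
    intro p
    refine (lintegral_hausdorffMeasure_image_le measurableSet_Icc (hψ p) (by fun_prop)).trans ?_
    refine mul_le_mul' le_rfl ?_
    -- The face `{x i = -1}` is reduced to `{x i = 1}` by the reflection `x ↦ -x`, which preserves
    -- Lebesgue measure.
    set Gσ : R3 → ℝ≥0∞ := fun x => G ((cond p.2 1 (-1) : ℝ) • x) with hGσ
    have hGσm : Measurable Gσ := hGm.comp (measurable_const_smul _)
    have hGσi : ∫⁻ x, Gσ x = ∫⁻ x, G x := by
      simp only [hGσ]
      cases p.2
      · simpa using lintegral_neg_eq_self (μ := (volume : Measure R3)) G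
      · simp
    calc ∫⁻ y in Set.Icc (-1) 1, ENNReal.ofReal (t * ‖φ (ψ p y)‖ ^ 2)
        ≤ ∫⁻ y in Set.Icc (-1) 1, ENNReal.ofReal (8 / r ^ 3 * (3 + 4 * R)) *
            ∫⁻ s in Set.Ioi (0 : ℝ), ENNReal.ofReal (s ^ 2) * Gσ (s • faceMap p.1 y) := by
          refine setLIntegral_mono' measurableSet_Icc fun y hy => ?_
          have h1 := ray_estimate h hR hK x₀ hφ ht
            (e := (cond p.2 1 (-1) : ℝ) • faceMap p.1 y)
            (by rw [hnorm]; exact one_le_norm_faceMap _ _)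
            (by rw [hnorm]; exact norm_faceMap_le _ hy)
          have h2 : ∀ s : ℝ, Gσ (s • faceMap p.1 y) =
              G (s • ((cond p.2 1 (-1) : ℝ) • faceMap p.1 y)) := fun s => by
            simp only [hGσ]; rw [smul_comm]
          simp only [h2]
          exact h1
      _ ≤ ∫⁻ y, ENNReal.ofReal (8 / r ^ 3 * (3 + 4 * R)) *
            ∫⁻ s in Set.Ioi (0 : ℝ), ENNReal.ofReal (s ^ 2) * Gσ (s • faceMap p.1 y) :=
          setLIntegral_le_lintegral _ _
      _ = ENNReal.ofReal (8 / r ^ 3 * (3 + 4 * R)) *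
            ∫⁻ y, ∫⁻ s in Set.Ioi (0 : ℝ), ENNReal.ofReal (s ^ 2) * Gσ (s • faceMap p.1 y) :=
          lintegral_const_mul' _ _ ENNReal.ofReal_ne_top
      _ ≤ _ := by
          rw [← hGσi]
          exact mul_le_mul' le_rfl (lintegral_cone_le p.1 hGσm)
  have hsum : ∫⁻ x in frontier Ω, ENNReal.ofReal (t * ‖φ x‖ ^ 2) ∂(Measure.hausdorffMeasure 2) ≤
      6 * ((L : ℝ≥0∞) ^ 2 * (ENNReal.ofReal (8 / r ^ 3 * (3 + 4 * R)) * ∫⁻ x, G x)) := by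
    refine (lintegral_mono_set hcover).trans ((lintegral_iUnion_le _ _).trans ?_)
    rw [tsum_fintype]
    refine (Finset.sum_le_sum fun p _ => hface p).trans (le_of_eq ?_)
    rw [Finset.sum_const, nsmul_eq_mul]
    norm_num
  rw [hsurf, lintegral_smul_measure, ← hGint]
  calc κ • ∫⁻ x in frontier Ω, ENNReal.ofReal (t * ‖φ x‖ ^ 2) ∂(Measure.hausdorffMeasure 2)
      ≤ (κ : ℝ≥0∞) * (6 * ((L : ℝ≥0∞) ^ 2 *
          (ENNReal.ofReal (8 / r ^ 3 * (3 + 4 * R)) * ∫⁻ x, G x))) := by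
        rw [ENNReal.smul_def, smul_eq_mul]
        exact mul_le_mul' le_rfl hsum
    _ = _ := by
        rw [ENNReal.ofReal_mul (p := (κ : ℝ)) (by positivity),
          ENNReal.ofReal_mul (p := (6 : ℝ)) (by positivity),
          ENNReal.ofReal_mul (p := (L : ℝ) ^ 2) (by positivity), ENNReal.ofReal_pow (by positivity),
          ENNReal.ofReal_coe_nnreal, ENNReal.ofReal_coe_nnreal]
        norm_num
        ring

end TraceInequality

/-! ### Averages over star centres: boundedness and convergence in L². -/

section Averages

variable {F : Type*} [NormedAddCommGroup F]

lemma lintegral_enorm_sq_eq (f : R3 → F) (μ : Measure R3) :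
    ∫⁻ x, ‖f x‖ₑ ^ 2 ∂μ = eLpNorm f 2 μ ^ 2 := by
  have := eLpNorm_nnreal_pow_eq_lintegral (f := f) (μ := μ) (p := 2) two_ne_zero
  simpa using this.symm

lemma lintegral_comp_affine {a : ℝ} (ha : 0 < a) (c : R3) {H : R3 → ℝ≥0∞} (hH : Measurable H) :
    ∫⁻ x, H (a • x + c) = ENNReal.ofReal (a ^ 3)⁻¹ * ∫⁻ x, H x := by
  have h1 : ∫⁻ x, H (a • x + c) = ∫⁻ y, H (y + c) ∂(Measure.map (a • ·) (volume : Measure R3)) :=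
    (lintegral_map (hH.comp (measurable_add_const c)) (measurable_const_smul a)).symm
  rw [h1, Measure.map_addHaar_smul volume ha.ne', lintegral_smul_measure, smul_eq_mul,
    lintegral_add_right_eq_self, finrank_euclideanSpace_fin, abs_of_pos (by positivity)]

lemma eLpNorm_comp_affine {a : ℝ} (ha : 0 < a) (c : R3) {f : R3 → F} (hf : StronglyMeasurable f) :
    eLpNorm (fun x => f (a • x + c)) 2 volume ^ 2
      = ENNReal.ofReal (a ^ 3)⁻¹ * eLpNorm f 2 volume ^ 2 := by
  rw [← lintegral_enorm_sq_eq, ← lintegral_enorm_sq_eq]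
  exact lintegral_comp_affine ha c (hf.enorm.pow_const 2)

lemma memLp_comp_affine {a : ℝ} (ha : 0 < a) (c : R3) {f : R3 → F} (hf : StronglyMeasurable f)
    (hf2 : MemLp f 2 volume) : MemLp (fun x => f (a • x + c)) 2 volume := by
  refine ⟨(hf.comp_measurable (by fun_prop)).aestronglyMeasurable, ?_⟩
  have h := eLpNorm_comp_affine ha c hf
  by_contra hc
  rw [not_lt, top_le_iff] at hc
  rw [hc] at h
  have h2 : ENNReal.ofReal (a ^ 3)⁻¹ * eLpNorm f 2 volume ^ 2 < ⊤ :=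
    ENNReal.mul_lt_top ENNReal.ofReal_lt_top (ENNReal.pow_lt_top hf2.2)
  rw [← h] at h2
  simp at h2

variable {ν : Measure R3} [IsProbabilityMeasure ν]

lemma integrable_comp_affine {c : ℝ≥0∞} (hc : c ≠ ⊤) (hν : ν ≤ c • volume) {a : ℝ} (ha : a < 1)
    {f : R3 → F} (hf : StronglyMeasurable f) (hf2 : MemLp f 2 volume) (x : R3) :
    Integrable (fun y => f (a • x + (1 - a) • y)) ν := by
  have h1 := memLp_comp_affine (sub_pos.2 ha) (a • x) hf hf2
  have h2 := (h1.of_measure_le_smul hc hν).integrable (by norm_num)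
  simpa only [add_comm] using h2

variable [NormedSpace ℝ F]

/-- The average of `f` over the points `a x + (1 - a) y`, where `y` is distributed according
to `ν`. -/
noncomputable def starAverage (ν : Measure R3) (a : ℝ) (f : R3 → F) (x : R3) : F :=
  ∫ y, f (a • x + (1 - a) • y) ∂ν

/-- Jensen's inequality: for a probability measure the L¹ norm is at most the L² norm. -/
lemma enorm_starAverage_sq_le (a : ℝ) {f : R3 → F} (hf : StronglyMeasurable f) (x : R3) :
    ‖starAverage ν a f x‖ₑ ^ 2 ≤ ∫⁻ y, ‖f (a • x + (1 - a) • y)‖ₑ ^ 2 ∂ν := by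
  have hm : StronglyMeasurable fun y => f (a • x + (1 - a) • y) :=
    hf.comp_measurable (by fun_prop)
  rw [lintegral_enorm_sq_eq]
  refine pow_le_pow_left₀ zero_le ?_ 2
  refine (enorm_integral_le_lintegral_enorm _).trans ?_
  rw [← eLpNorm_one_eq_lintegral_enorm]
  exact eLpNorm_le_eLpNorm_of_exponent_le (by norm_num) hm.aestronglyMeasurable

lemma eLpNorm_starAverage_sq_le {a : ℝ} (ha : 0 < a) {f : R3 → F} (hf : StronglyMeasurable f) :
    eLpNorm (starAverage ν a f) 2 volume ^ 2 ≤
      ENNReal.ofReal (a ^ 3)⁻¹ * eLpNorm f 2 volume ^ 2 := by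
  rw [← lintegral_enorm_sq_eq]
  refine (lintegral_mono fun x => enorm_starAverage_sq_le (ν := ν) a hf x).trans ?_
  rw [lintegral_lintegral_swap]
  · have h : ∀ y, ∫⁻ x, ‖f (a • x + (1 - a) • y)‖ₑ ^ 2 =
        ENNReal.ofReal (a ^ 3)⁻¹ * eLpNorm f 2 volume ^ 2 := fun y => by
      rw [← eLpNorm_comp_affine ha ((1 - a) • y) hf, ← lintegral_enorm_sq_eq]
    simp [h]
  · refine Measurable.aemeasurable ?_
    exact (hf.enorm.comp
      (by fun_prop : Measurable fun q : R3 × R3 => a • q.1 + (1 - a) • q.2)).pow_const 2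

/-- Here `a ^ (-3) ≤ 8 ≤ 3 ^ 2`. Uniformity in `a` is what the approximation argument for
convergence requires. -/
lemma eLpNorm_starAverage_le {a : ℝ} (ha : 1 / 2 ≤ a) {f : R3 → F} (hf : StronglyMeasurable f) :
    eLpNorm (starAverage ν a f) 2 volume ≤ 3 * eLpNorm f 2 volume := by
  have h := eLpNorm_starAverage_sq_le (ν := ν) (by linarith : 0 < a) hf
  have h2 : ENNReal.ofReal (a ^ 3)⁻¹ ≤ 3 ^ 2 := by
    rw [show (3 : ℝ≥0∞) ^ 2 = ENNReal.ofReal 9 by norm_num]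
    refine ENNReal.ofReal_le_ofReal ?_
    rw [inv_le_comm₀ (by positivity) (by norm_num)]
    have : (1 / 2 : ℝ) ^ 3 ≤ a ^ 3 := by gcongr
    linarith
  have h3 : eLpNorm (starAverage ν a f) 2 volume ^ 2 ≤ (3 * eLpNorm f 2 volume) ^ 2 := by
    rw [mul_pow]
    exact h.trans (mul_le_mul' h2 le_rfl)
  exact (ENNReal.pow_le_pow_left_iff two_ne_zero).1 h3

/-- The averaged points differ from `x` by `(1 - a) • (y - x)`, of norm at most `(1 - a) * (M + R)`,
so uniform continuity applies. -/
lemma norm_starAverage_sub_le [CompleteSpace F] {M : ℝ} (hM : ∀ᵐ y ∂ν, ‖y‖ ≤ M)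
    {g : R3 → F} (hg : Continuous g)
    (hgs : HasCompactSupport g) {ε δ : ℝ} (hgδ : ∀ x y, dist x y < δ → dist (g x) (g y) < ε)
    {a : ℝ} (ha : a < 1) {x : R3} {R : ℝ} (hx : ‖x‖ ≤ R) (had : (1 - a) * (M + R) < δ) :
    ‖starAverage ν a g x - g x‖ ≤ ε := by
  obtain ⟨B, hB⟩ := hgs.exists_bound_of_continuous hg
  have hi : Integrable (fun y => g (a • x + (1 - a) • y)) ν :=
    (integrable_const B).mono' (hg.comp (by fun_prop)).aestronglyMeasurable
      (Eventually.of_forall fun y => hB _)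
  have h1 : starAverage ν a g x - g x = ∫ y, (g (a • x + (1 - a) • y) - g x) ∂ν := by
    rw [integral_sub hi (integrable_const _)]
    simp [starAverage]
  rw [h1]
  have h2 := norm_integral_le_of_norm_le_const (μ := ν)
    (f := fun y => g (a • x + (1 - a) • y) - g x) (C := ε) ?_
  · simpa using h2
  · filter_upwards [hM] with y hy
    rw [← dist_eq_norm]
    refine (hgδ _ _ ?_).le
    rw [dist_eq_norm, show a • x + (1 - a) • y - x = (1 - a) • (y - x) by module, norm_smul,
      Real.norm_of_nonneg (by linarith)]
    refine lt_of_le_of_lt ?_ had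
    have : ‖y - x‖ ≤ M + R := (norm_sub_le _ _).trans (add_le_add hy hx)
    have : 0 ≤ 1 - a := by linarith
    gcongr

/-- Averages over points of a star centre converge in `L²` on bounded sets. -/
theorem tendsto_eLpNorm_starAverage_sub [CompleteSpace F] {c : ℝ≥0∞} (hc : c ≠ ⊤)
    (hν : ν ≤ c • volume) {M : ℝ} (hM : ∀ᵐ y ∂ν, ‖y‖ ≤ M) {Ω : Set R3} (hΩ : MeasurableSet Ω)
    (hΩb : Bornology.IsBounded Ω) {f : R3 → F} (hf : StronglyMeasurable f)
    (hf2 : MemLp f 2 volume) {a : ℕ → ℝ} (ha : ∀ n, 1 / 2 ≤ a n) (ha1 : ∀ n, a n < 1)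
    (hlim : Tendsto a atTop (𝓝 1)) :
    Tendsto (fun n => eLpNorm (fun x => starAverage ν (a n) f x - f x) 2 (volume.restrict Ω))
      atTop (𝓝 0) := by
  obtain ⟨R, hR⟩ := hΩb.exists_norm_le
  have hV : volume Ω ≠ ⊤ := hΩb.measure_lt_top.ne
  rw [ENNReal.tendsto_nhds_zero]
  intro ε hε
  wlog hεt : ε ≠ ⊤ generalizing ε
  · filter_upwards [this 1 one_pos ENNReal.one_ne_top] with n _
    rw [not_not.1 hεt]; exact le_top
  set ε' : ℝ≥0∞ := ε / 8 with hε'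
  have hε'0 : ε' ≠ 0 := (ENNReal.div_pos hε.ne' (by norm_num)).ne'
  have hε't : ε' ≠ ⊤ := ENNReal.div_ne_top hεt (by norm_num)
  obtain ⟨g, hgs, hfg, hgc, hg2⟩ :=
    hf2.exists_hasCompactSupport_eLpNorm_sub_le (by norm_num : (2 : ℝ≥0∞) ≠ ⊤) hε'0
  have hgm : StronglyMeasurable g := hgc.stronglyMeasurable
  obtain ⟨e, he, heV⟩ : ∃ e : ℝ, 0 < e ∧
      (volume.restrict Ω) Set.univ ^ (2 : ℝ≥0∞).toReal⁻¹ * ENNReal.ofReal e ≤ ε' := by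
    have hV' : (volume.restrict Ω) Set.univ ^ (2 : ℝ≥0∞).toReal⁻¹ ≠ ⊤ := by
      rw [Measure.restrict_apply_univ]
      exact ENNReal.rpow_ne_top_of_nonneg (by positivity) hV
    set V := (volume.restrict Ω) Set.univ ^ (2 : ℝ≥0∞).toReal⁻¹
    have hp : 0 < ε' / (V + 1) := ENNReal.div_pos hε'0 (by simp [hV'])
    have hpt : ε' / (V + 1) ≠ ⊤ := ENNReal.div_ne_top hε't (by simp)
    refine ⟨(ε' / (V + 1)).toReal, ENNReal.toReal_pos hp.ne' hpt, ?_⟩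
    rw [ENNReal.ofReal_toReal hpt]
    calc V * (ε' / (V + 1)) ≤ (V + 1) * (ε' / (V + 1)) := by gcongr; exact le_self_add
      _ ≤ ε' := ENNReal.mul_div_le
  obtain ⟨δ, hδ, hgδ⟩ := Metric.uniformContinuous_iff.1
    (hgc.uniformContinuous_of_tendsto_cocompact hgs.is_zero_at_infty) e he
  have hev : ∀ᶠ n in atTop, (1 - a n) * (M + R) < δ := by
    have : Tendsto (fun n => (1 - a n) * (M + R)) atTop (𝓝 ((1 - 1) * (M + R))) :=
      (tendsto_const_nhds.sub hlim).mul_const _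
    rw [sub_self, zero_mul] at this
    exact this.eventually (gt_mem_nhds hδ)
  filter_upwards [hev] with n hn
  -- Replacing `f` by the continuous `g` costs `3 * ε'` in the average and `ε'` in the function; the
  -- error for `g` itself costs `ε'`. The total `5 * ε'` fits into `8 * ε' ≤ ε`.
  have hsplit : (fun x => starAverage ν (a n) f x - f x) =
      starAverage ν (a n) (f - g) + ((fun x => starAverage ν (a n) g x - g x) - (f - g)) := by
    funext x
    have := integral_sub (integrable_comp_affine hc hν (ha1 n) hf hf2 x)
      (integrable_comp_affine hc hν (ha1 n) hgm hg2 x)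
    have h2 : starAverage ν (a n) (f - g) x =
        starAverage ν (a n) f x - starAverage ν (a n) g x := this
    simp only [Pi.add_apply, Pi.sub_apply, h2]
    abel
  have hms : ∀ h : R3 → F, StronglyMeasurable h → StronglyMeasurable (starAverage ν (a n) h) := by
    intro h hh
    exact StronglyMeasurable.integral_prod_right (f := fun x y => h (a n • x + (1 - a n) • y))
      (hh.comp_measurable (by fun_prop : Measurable fun q : R3 × R3 => a n • q.1 + (1 - a n) • q.2))
  have b1 : eLpNorm (starAverage ν (a n) (f - g)) 2 (volume.restrict Ω) ≤ 3 * ε' :=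
    (eLpNorm_mono_measure _ Measure.restrict_le_self).trans
      ((eLpNorm_starAverage_le (ha n) (hf.sub hgm)).trans (by gcongr))
  have b2 : eLpNorm (fun x => starAverage ν (a n) g x - g x) 2 (volume.restrict Ω) ≤ ε' := by
    refine (eLpNorm_le_of_ae_bound (C := e) ?_).trans heV
    filter_upwards [ae_restrict_mem hΩ] with x hx
    exact norm_starAverage_sub_le hM hgc hgs (fun x y => hgδ (a := x) (b := y)) (ha1 n) (hR x hx) hn
  have b3 : eLpNorm (f - g) 2 (volume.restrict Ω) ≤ ε' :=
    (eLpNorm_mono_measure _ Measure.restrict_le_self).trans hfg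
  rw [hsplit]
  refine (eLpNorm_add_le (hms _ (hf.sub hgm)).aestronglyMeasurable
    (((hms _ hgm).sub hgm).sub (hf.sub hgm)).aestronglyMeasurable (by norm_num)).trans ?_
  refine (add_le_add b1 ((eLpNorm_sub_le ((hms _ hgm).sub hgm).aestronglyMeasurable
    (hf.sub hgm).aestronglyMeasurable (by norm_num)).trans (add_le_add b2 b3))).trans ?_
  calc 3 * ε' + (ε' + ε') = 5 * ε' := by ring
    _ ≤ 8 * ε' := by gcongr; norm_num
    _ ≤ ε := ENNReal.mul_div_le

end Averages

/-! ### Averages as convolutions: smoothness and commutation with the gradient. -/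

section BumpMeasure

variable {x₀ : R3} (b : ContDiffBump x₀)

/-- The probability measure whose density is a normalised bump function. -/
noncomputable def bumpMeasure : Measure R3 :=
  (volume : Measure R3).withDensity fun y => ENNReal.ofReal (b.normed volume y)

instance : IsProbabilityMeasure (bumpMeasure b) := by
  constructor
  rw [bumpMeasure, withDensity_apply _ MeasurableSet.univ, Measure.restrict_univ,
    ← ofReal_integral_eq_lintegral_ofReal b.integrable_normed
      (Eventually.of_forall b.nonneg_normed), b.integral_normed, ENNReal.ofReal_one]

lemma bumpMeasure_le_smul : ∃ c : ℝ≥0∞, c ≠ ⊤ ∧ bumpMeasure b ≤ c • volume := by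
  obtain ⟨B, hB⟩ := b.hasCompactSupport_normed.exists_bound_of_continuous
    (b.continuous_normed (μ := (volume : Measure R3)))
  refine ⟨ENNReal.ofReal B, ENNReal.ofReal_ne_top, ?_⟩
  rw [bumpMeasure, ← withDensity_const]
  exact withDensity_mono (Eventually.of_forall fun y =>
    ENNReal.ofReal_le_ofReal ((le_abs_self _).trans (hB y)))

lemma ae_bumpMeasure_norm_le : ∃ M : ℝ, ∀ᵐ y ∂(bumpMeasure b), ‖y‖ ≤ M := by
  refine ⟨‖x₀‖ + b.rOut, ?_⟩
  have hm : Measurable fun y => ENNReal.ofReal (b.normed (volume : Measure R3) y) :=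
    b.continuous_normed.measurable.ennreal_ofReal
  rw [bumpMeasure, ae_withDensity_iff hm]
  refine Eventually.of_forall fun y hy => ?_
  have hs : y ∈ Function.support (b.normed (volume : Measure R3)) := by
    intro h0; rw [h0] at hy; simp at hy
  rw [b.support_normed_eq, Metric.mem_ball, dist_eq_norm] at hs
  calc ‖y‖ = ‖x₀ + (y - x₀)‖ := by rw [add_sub_cancel]
    _ ≤ ‖x₀‖ + ‖y - x₀‖ := norm_add_le _ _
    _ ≤ _ := by gcongr

/-- The convolution kernel of the averages with respect to a bump measure. -/
noncomputable def bumpKernel (a : ℝ) (w : R3) : ℝ :=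
  ((1 - a) ^ 3)⁻¹ * b.normed volume (-((1 - a)⁻¹ • w))

lemma contDiff_bumpKernel (a : ℝ) : ContDiff ℝ ∞ (bumpKernel b a) := by
  unfold bumpKernel
  have := b.contDiff_normed (μ := (volume : Measure R3)) (n := ⊤)
  exact contDiff_const.mul (this.comp (by fun_prop))

lemma support_bumpKernel_sub_subset {a : ℝ} (ha : a < 1) (x : R3) :
    Function.support (fun z => bumpKernel b a (x - z)) ⊆
      (fun y => x + (1 - a) • y) '' Metric.closedBall x₀ b.rOut := by
  intro z hz
  have h1 : -((1 - a)⁻¹ • (x - z)) ∈ Function.support (b.normed (volume : Measure R3)) :=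
    right_ne_zero_of_mul hz
  rw [b.support_normed_eq] at h1
  refine ⟨_, Metric.ball_subset_closedBall h1, ?_⟩
  have h0 : 1 - a ≠ 0 := (sub_pos.2 ha).ne'
  simp only [smul_neg, smul_smul, mul_inv_cancel₀ h0, one_smul]
  abel

lemma isCompact_bumpKernel_image (a : ℝ) (x : R3) :
    IsCompact ((fun y => x + (1 - a) • y) '' Metric.closedBall x₀ b.rOut) :=
  (isCompact_closedBall _ _).image (by fun_prop)

lemma hasCompactSupport_bumpKernel {a : ℝ} (ha : a < 1) : HasCompactSupport (bumpKernel b a) := by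
  have h : HasCompactSupport fun z => bumpKernel b a (0 - z) :=
    HasCompactSupport.of_support_subset_isCompact (isCompact_bumpKernel_image b a 0)
      (support_bumpKernel_sub_subset b ha 0)
  have h2 := h.comp_homeomorph (Homeomorph.neg R3)
  simpa [Function.comp_def] using h2

/-- The support consists of points `a • x + (1 - a) • y` with `y` in a closed ball of centres, a
compact set that star-shapedness keeps inside `Ω`. The kernel may therefore be inserted in the
definition of the weak gradient. -/
lemma isTestFunction_bumpKernel {Ω : Set R3}
    (hΩ : ∀ y ∈ Metric.closedBall x₀ b.rOut, StarConvex ℝ y Ω) {a : ℝ} (ha0 : 0 < a) (ha : a < 1)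
    {x : R3} (hx : x ∈ Ω) : IsTestFunction Ω fun z => bumpKernel b a (a • x - z) where
  contDiff := (contDiff_bumpKernel b a).comp (by fun_prop)
  hasCompactSupport := HasCompactSupport.of_support_subset_isCompact
    (isCompact_bumpKernel_image b a _) (support_bumpKernel_sub_subset b ha _)
  tsupport_subset := by
    refine (closure_minimal (support_bumpKernel_sub_subset b ha _)
      (isCompact_bumpKernel_image b a _).isClosed).trans ?_
    rintro _ ⟨y, hy, rfl⟩
    have := hΩ y hy hx (sub_pos.2 ha).le ha0.le (by ring)
    simp only
    rwa [add_comm]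

variable {F : Type*} [NormedAddCommGroup F] [NormedSpace ℝ F]

lemma starAverage_bumpMeasure_eq {a : ℝ} (ha : a < 1) (f : R3 → F) (x : R3) :
    starAverage (bumpMeasure b) a f x = ∫ z, bumpKernel b a (a • x - z) • f z := by
  have h0 : 0 < 1 - a := sub_pos.2 ha
  have hm : Measurable fun y => ENNReal.ofReal (b.normed (volume : Measure R3) y) :=
    b.continuous_normed.measurable.ennreal_ofReal
  rw [starAverage, bumpMeasure, integral_withDensity_eq_integral_toReal_smul hm
    (Eventually.of_forall fun _ => ENNReal.ofReal_lt_top),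
    ← integral_add_left_eq_self (fun z => bumpKernel b a (a • x - z) • f z) (a • x)]
  -- The Jacobian of the substitution `z = a • x + (1 - a) • y` cancels the prefactor of
  -- `bumpKernel`.
  have h1 := Measure.integral_comp_smul (volume : Measure R3)
    (fun y => b.normed volume y • f (a • x + (1 - a) • y)) (1 - a)⁻¹
  have h2 : ∀ z, bumpKernel b a (a • x - (a • x + z)) • f (a • x + z) = ((1 - a) ^ 3)⁻¹ •
      (b.normed volume ((1 - a)⁻¹ • z) • f (a • x + (1 - a) • ((1 - a)⁻¹ • z))) := by
    intro z
    rw [smul_smul (1 - a), mul_inv_cancel₀ h0.ne', one_smul, bumpKernel, smul_smul]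
    congr 3
    simp
  simp only [h2]
  rw [integral_smul, h1, smul_smul, finrank_euclideanSpace_fin, abs_of_pos (by positivity)]
  simp only [ENNReal.toReal_ofReal (b.nonneg_normed _)]
  rw [show ((1 - a) ^ 3)⁻¹ * (((1 - a)⁻¹ ^ 3)⁻¹) = 1 by field_simp, one_smul]

lemma starAverage_eq_convolution {a : ℝ} (ha : a < 1) (f : R3 → F) :
    starAverage (bumpMeasure b) a f = fun x =>
      convolution f (bumpKernel b a) (ContinuousLinearMap.lsmul ℝ ℝ).flip volume (a • x) := by
  funext x
  rw [starAverage_bumpMeasure_eq b ha]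
  rfl

lemma contDiff_starAverage [CompleteSpace F] {a : ℝ} (ha : a < 1) {f : R3 → F}
    (hf : MemLp f 2 volume) :
    ContDiff ℝ ∞ (starAverage (bumpMeasure b) a f) := by
  rw [starAverage_eq_convolution b ha]
  have h1 := (hasCompactSupport_bumpKernel b ha).contDiff_convolution_right (n := ⊤)
    (ContinuousLinearMap.lsmul ℝ ℝ).flip (hf.locallyIntegrable (by norm_num))
    (contDiff_bumpKernel b a)
  exact h1.comp (contDiff_const_smul a)

lemma partialDeriv_starAverage [CompleteSpace F] {a : ℝ} (ha : a < 1) {f : R3 → F}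
    (hf : MemLp f 2 volume) (i : Fin 3) (x : R3) :
    partialDeriv i (starAverage (bumpMeasure b) a f) x =
      a • ∫ z, partialDeriv i (bumpKernel b a) (a • x - z) • f z := by
  have hk := contDiff_bumpKernel b a
  have hkc := hasCompactSupport_bumpKernel b ha
  have hl : LocallyIntegrable f volume := hf.locallyIntegrable (by norm_num)
  have h1 := hkc.hasFDerivAt_convolution_right (ContinuousLinearMap.lsmul ℝ ℝ).flip hl
    (hk.of_le (by simp)) (a • x)
  have h2 : HasFDerivAt (fun x : R3 => a • x) (a • ContinuousLinearMap.id ℝ R3) x :=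
    (hasFDerivAt_id x).const_smul a
  have h3 : HasFDerivAt (fun x : R3 => convolution f (bumpKernel b a)
      (ContinuousLinearMap.lsmul ℝ ℝ).flip volume (a • x)) _ x := h1.comp x h2
  rw [partialDeriv, starAverage_eq_convolution b ha, h3.fderiv]
  simp only [ContinuousLinearMap.comp_apply, smul_apply,
    ContinuousLinearMap.id_apply, map_smul]
  rw [convolution_precompR_apply _ hl (hkc.fderiv ℝ) (hk.continuous_fderiv (by simp))]
  rfl

variable {Ω : Set R3}

lemma memLp_indicator {F : Type*} [NormedAddCommGroup F] {p : Lp F 2 (volume.restrict Ω)}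
    (hΩ : MeasurableSet Ω) :
    MemLp (Ω.indicator p) 2 volume :=
  (memLp_indicator_iff_restrict hΩ).2 (Lp.memLp p)

/-- Averaging commutes with differentiation, up to a factor. -/
lemma classicalGrad_starAverage (hΩm : MeasurableSet Ω)
    (hΩ : ∀ y ∈ Metric.closedBall x₀ b.rOut, StarConvex ℝ y Ω) {a : ℝ} (ha0 : 0 < a) (ha : a < 1)
    (u : H1 Ω) {x : R3} (hx : x ∈ Ω) :
    classicalGrad (starAverage (bumpMeasure b) a (Ω.indicator (toL2 u))) x =
      a • starAverage (bumpMeasure b) a (Ω.indicator (grad u)) x := by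
  ext i
  have ht := isTestFunction_bumpKernel b hΩ ha0 ha hx
  have hk := contDiff_bumpKernel b a
  -- The sign from differentiating `a • x - z` in `z` cancels the one in the definition of the weak
  -- gradient.
  have hpd : ∀ z, partialDeriv i (fun z => bumpKernel b a (a • x - z)) z =
      -partialDeriv i (bumpKernel b a) (a • x - z) := by
    intro z
    have h1 : HasFDerivAt (fun z : R3 => a • x - z) (-ContinuousLinearMap.id ℝ R3) z :=
      (hasFDerivAt_id z).const_sub (a • x)
    have h2 : HasFDerivAt (fun z => bumpKernel b a (a • x - z)) _ z :=
      ((hk.differentiable (by simp)) (a • x - z)).hasFDerivAt.comp z h1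
    rw [partialDeriv, h2.fderiv]
    simp [partialDeriv]
  have hw := u.2 _ ht i
  have hleft : ∫ z, partialDeriv i (bumpKernel b a) (a • x - z) • Ω.indicator (toL2 u) z =
      - ∫ z in Ω, toL2 u z *
        ((partialDeriv i (fun z => bumpKernel b a (a • x - z)) z : ℝ) : ℂ) := by
    rw [← integral_indicator hΩm, ← integral_neg]
    refine integral_congr_ae (Eventually.of_forall fun z => ?_)
    simp only [hpd]
    by_cases hz : z ∈ Ω
    · simp [hz, mul_comm]
    · simp [hz]
  have hright : (starAverage (bumpMeasure b) a (Ω.indicator (grad u)) x) i =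
      ∫ z in Ω, (grad u z) i * ((bumpKernel b a (a • x - z) : ℝ) : ℂ) := by
    have hint : Integrable fun z => bumpKernel b a (a • x - z) • Ω.indicator (grad u) z :=
      (hasCompactSupport_bumpKernel b ha).convolutionExists_right
        (ContinuousLinearMap.lsmul ℝ ℝ).flip
        ((memLp_indicator hΩm).locallyIntegrable (by norm_num)) hk.continuous (a • x)
    have h1 := ((EuclideanSpace.proj (𝕜 := ℂ) i : C3 →L[ℂ] ℂ)).integral_comp_comm hint
    rw [starAverage_bumpMeasure_eq b ha, ← integral_indicator hΩm]
    refine h1.symm.trans (integral_congr_ae (Eventually.of_forall fun z => ?_))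
    by_cases hz : z ∈ Ω
    · simp [hz, mul_comm]
    · simp [hz]
  have hL : classicalGrad (starAverage (bumpMeasure b) a (Ω.indicator (toL2 u))) x i =
      partialDeriv i (starAverage (bumpMeasure b) a (Ω.indicator (toL2 u))) x := rfl
  rw [hL, partialDeriv_starAverage b ha (memLp_indicator hΩm), hleft, PiLp.smul_apply, hright]
  congr 1
  rw [neg_eq_iff_eq_neg]
  exact hw

end BumpMeasure

/-- Functions that are smooth on the whole space are dense in `H¹(Ω)`. -/
theorem exists_contDiff_tendsto {Ω : Set R3} (hΩ : IsAdmissibleDomain Ω) (u : H1 Ω) :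
    ∃ φ : ℕ → R3 → ℂ, (∀ n, ContDiff ℝ ∞ (φ n)) ∧
      Tendsto (fun n => eLpNorm (fun x => φ n x - toL2 u x) 2 (volume.restrict Ω)) atTop (𝓝 0) ∧
      Tendsto (fun n => eLpNorm (fun x => classicalGrad (φ n) x - grad u x) 2
        (volume.restrict Ω)) atTop (𝓝 0) := by
  obtain ⟨x₀, r, hr, -, hstar⟩ := hΩ.starShaped
  have hm := hΩ.isOpen.measurableSet
  -- The outer radius `r / 2` keeps the closed support ball inside the open ball of centres.
  let b : ContDiffBump x₀ := ⟨r / 4, r / 2, by positivity, by linarith⟩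
  have hb : ∀ y ∈ Metric.closedBall x₀ b.rOut, StarConvex ℝ y Ω := fun y hy =>
    hstar y (Metric.closedBall_subset_ball (by change r / 2 < r; linarith) hy)
  obtain ⟨c, hc, hν⟩ := bumpMeasure_le_smul b
  obtain ⟨M, hM⟩ := ae_bumpMeasure_norm_le b
  let a : ℕ → ℝ := fun n => 1 - 1 / ((n : ℝ) + 2)
  have ha1 : ∀ n, a n < 1 := fun n => by
    have : (0 : ℝ) < 1 / ((n : ℝ) + 2) := by positivity
    simp only [a]; linarith
  have ha : ∀ n, 1 / 2 ≤ a n := fun n => by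
    have : 1 / ((n : ℝ) + 2) ≤ 1 / 2 := by gcongr; linarith [(Nat.cast_nonneg n : (0 : ℝ) ≤ n)]
    simp only [a]; linarith
  have hlim0 : Tendsto (fun n : ℕ => 1 / ((n : ℝ) + 2)) atTop (𝓝 0) := by
    refine tendsto_const_nhds.div_atTop ?_
    exact tendsto_atTop_add_const_right _ _ tendsto_natCast_atTop_atTop
  have hlim : Tendsto a atTop (𝓝 1) := by
    have h := (tendsto_const_nhds (x := (1 : ℝ))).sub hlim0
    rwa [sub_zero] at h
  have hsm : ∀ {F : Type} [NormedAddCommGroup F] (p : Lp F 2 (volume.restrict Ω)),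
      StronglyMeasurable (Ω.indicator p) := fun p => (Lp.stronglyMeasurable p).indicator hm
  refine ⟨fun n => starAverage (bumpMeasure b) (a n) (Ω.indicator (toL2 u)),
    fun n => contDiff_starAverage b (ha1 n) (memLp_indicator hm), ?_, ?_⟩
  · have h := tendsto_eLpNorm_starAverage_sub hc hν hM hm hΩ.isBounded (hsm (toL2 u))
      (memLp_indicator hm) ha ha1 hlim
    refine h.congr fun n => eLpNorm_congr_ae ?_
    filter_upwards [ae_restrict_mem hm] with x hx
    rw [Set.indicator_of_mem hx]
  · have h := tendsto_eLpNorm_starAverage_sub hc hν hM hm hΩ.isBounded (hsm (grad u))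
      (memLp_indicator hm) ha ha1 hlim
    have h2 : Tendsto (fun n : ℕ => ENNReal.ofReal (1 / ((n : ℝ) + 2)) *
        eLpNorm (grad u) 2 (volume.restrict Ω)) atTop (𝓝 0) := by
      have := ENNReal.Tendsto.mul_const (b := eLpNorm (grad u) 2 (volume.restrict Ω))
        (ENNReal.tendsto_ofReal hlim0) (Or.inr (Lp.eLpNorm_ne_top _))
      simpa using this
    refine tendsto_of_tendsto_of_tendsto_of_le_of_le tendsto_const_nhds
      (by have h3 := h.add h2; rwa [add_zero] at h3) (fun _ => zero_le) fun n => ?_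
    set A := starAverage (bumpMeasure b) (a n) (Ω.indicator (grad u)) with hA
    have hAm : AEStronglyMeasurable A (volume.restrict Ω) :=
      (contDiff_starAverage b (ha1 n) (memLp_indicator hm)).continuous.aestronglyMeasurable
    have hGm : AEStronglyMeasurable (Ω.indicator (grad u)) (volume.restrict Ω) :=
      (hsm (grad u)).aestronglyMeasurable
    have hgm := (Lp.stronglyMeasurable (grad u)).aestronglyMeasurable (μ := volume.restrict Ω)
    -- With `G` the gradient of `u`, `a • A - G = a • (A - G) - (1 - a) • G`: the first term is
    -- small by convergence of the averages, the second because `1 - a` tends to 0.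
    have heq : eLpNorm (fun x => classicalGrad (starAverage (bumpMeasure b) (a n)
        (Ω.indicator (toL2 u))) x - grad u x) 2 (volume.restrict Ω) =
        eLpNorm (a n • (A - Ω.indicator (grad u)) - (1 / ((n : ℝ) + 2)) • (grad u : R3 → C3)) 2
          (volume.restrict Ω) := by
      refine eLpNorm_congr_ae ?_
      filter_upwards [ae_restrict_mem hm] with x hx
      rw [classicalGrad_starAverage b hm hb (by linarith [ha n]) (ha1 n) u hx]
      simp only [Pi.sub_apply, Pi.smul_apply, Set.indicator_of_mem hx, a]
      module
    simp only
    rw [heq]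
    refine (eLpNorm_sub_le ((hAm.sub hGm).const_smul _) (hgm.const_smul _) (by norm_num)).trans ?_
    refine add_le_add ?_ (le_of_eq ?_)
    · rw [eLpNorm_const_smul]
      have h1 : ‖a n‖ₑ ≤ 1 := by
        rw [Real.enorm_eq_ofReal (by linarith [ha n])]
        exact ENNReal.ofReal_le_one.2 (ha1 n).le
      calc _ ≤ 1 * eLpNorm (A - Ω.indicator (grad u)) 2 (volume.restrict Ω) := by gcongr
        _ = _ := by rw [one_mul]; rfl
    · rw [eLpNorm_const_smul, Real.enorm_eq_ofReal (by positivity)]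

variable {Ω : Set R3}

/-! ### The trace as a limit of smooth triples. -/

section Traces

lemma memLp_restrict_of_continuous {F : Type*} [NormedAddCommGroup F] [SecondCountableTopology F]
    (hΩ : Bornology.IsBounded Ω)
    {f : R3 → F} (hf : Continuous f) : MemLp f 2 (volume.restrict Ω) := by
  have : IsFiniteMeasure (volume.restrict (closure Ω)) :=
    ⟨by simpa using hΩ.isCompact_closure.measure_lt_top⟩
  obtain ⟨B, hB⟩ := hΩ.isCompact_closure.exists_bound_of_continuousOn hf.continuousOn
  exact (MemLp.of_bound hf.aestronglyMeasurable B
    (ae_restrict_of_forall_mem isClosed_closure.measurableSet hB)).mono_measure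
    (Measure.restrict_mono subset_closure le_rfl)

lemma tendsto_Lp_iff_of_ae_eq {F : Type*} [NormedAddCommGroup F] {μ : Measure R3}
    {P : ℕ → Lp F 2 μ} {p : Lp F 2 μ} {φ : ℕ → R3 → F} (h : ∀ n, P n =ᵐ[μ] φ n) :
    Tendsto P atTop (𝓝 p) ↔ Tendsto (fun n => eLpNorm (fun x => φ n x - p x) 2 μ) atTop (𝓝 0) := by
  rw [Lp.tendsto_Lp_iff_tendsto_eLpNorm']
  refine tendsto_congr fun n => eLpNorm_congr_ae ?_
  filter_upwards [h n] with x hx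
  rw [Pi.sub_apply, hx]

lemma classicalGrad_add {φ ψ : R3 → ℂ} (hφ : ContDiff ℝ ∞ φ) (hψ : ContDiff ℝ ∞ ψ) (x : R3) :
    classicalGrad (φ + ψ) x = classicalGrad φ x + classicalGrad ψ x := by
  ext i
  simp [classicalGrad, partialDeriv, fderiv_add (hφ.differentiable (by simp) x)
    (hψ.differentiable (by simp) x)]

lemma classicalGrad_smul {φ : R3 → ℂ} (c : ℂ) (hφ : ContDiff ℝ ∞ φ) (x : R3) :
    classicalGrad (c • φ) x = c • classicalGrad φ x := by
  ext i
  simp [classicalGrad, partialDeriv, fderiv_const_smul (hφ.differentiable (by simp) x) c]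

/-- The triples formed by a smooth function, its gradient, and its boundary values. -/
def smoothTriples (Ω : Set R3) : Submodule ℂ (L2 Ω × L2Vec Ω × L2Bdry Ω) where
  carrier := {p | ∃ φ : R3 → ℂ, ContDiff ℝ ∞ φ ∧ p.1 =ᵐ[volume.restrict Ω] φ ∧
    p.2.1 =ᵐ[volume.restrict Ω] classicalGrad φ ∧ p.2.2 =ᵐ[surfaceMeasure Ω] φ}
  zero_mem' := by
    refine ⟨0, contDiff_const, Lp.coeFn_zero _ _ _, ?_, Lp.coeFn_zero _ _ _⟩
    have h : classicalGrad 0 = 0 := by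
      funext x; ext i; simp [classicalGrad, partialDeriv]
    rw [h]
    exact Lp.coeFn_zero _ _ _
  add_mem' := by
    rintro p q ⟨φ, hφ, h1, h2, h3⟩ ⟨ψ, hψ, k1, k2, k3⟩
    refine ⟨φ + ψ, hφ.add hψ, (Lp.coeFn_add _ _).trans (h1.add k1), ?_,
      (Lp.coeFn_add _ _).trans (h3.add k3)⟩
    filter_upwards [Lp.coeFn_add p.2.1 q.2.1, h2, k2] with x e1 e2 e3
    rw [classicalGrad_add hφ hψ, ← e2, ← e3]
    exact e1
  smul_mem' := by
    rintro c p ⟨φ, hφ, h1, h2, h3⟩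
    refine ⟨c • φ, hφ.const_smul c, (Lp.coeFn_smul _ _).trans (h1.const_smul c), ?_,
      (Lp.coeFn_smul _ _).trans (h3.const_smul c)⟩
    filter_upwards [Lp.coeFn_smul c p.2.1, h2] with x e1 e2
    rw [classicalGrad_smul c hφ, ← e2]
    exact e1

/-- `C` is a constant in the weighted trace inequality for smooth functions. -/
def IsSmoothTraceConstant (Ω : Set R3) (C : ℝ) : Prop :=
  ∀ φ : R3 → ℂ, ContDiff ℝ ∞ φ → ∀ t : ℝ, 1 ≤ t →
    ENNReal.ofReal t * eLpNorm φ 2 (surfaceMeasure Ω) ^ 2 ≤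
      ENNReal.ofReal C * (ENNReal.ofReal (t ^ 2) * eLpNorm φ 2 (volume.restrict Ω) ^ 2 +
        eLpNorm (classicalGrad φ) 2 (volume.restrict Ω) ^ 2)

lemma exists_isSmoothTraceConstant (hΩ : IsAdmissibleDomain Ω) :
    ∃ C : ℝ, 0 ≤ C ∧ IsSmoothTraceConstant Ω C := by
  obtain ⟨C, hC, h⟩ := exists_lintegral_surfaceMeasure_le hΩ
  refine ⟨C, hC, fun φ hφ t ht => ?_⟩
  have h1 := h φ hφ t ht
  have ht0 : 0 ≤ t := by linarith
  have e : ∀ z : ℂ, ENNReal.ofReal (‖z‖ ^ 2) = ‖z‖ₑ ^ 2 := fun z => by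
    rw [ENNReal.ofReal_pow (norm_nonneg _), ofReal_norm]
  have e' : ∀ z : C3, ENNReal.ofReal (‖z‖ ^ 2) = ‖z‖ₑ ^ 2 := fun z => by
    rw [ENNReal.ofReal_pow (norm_nonneg _), ofReal_norm]
  have hφm : Measurable fun x => ‖φ x‖ₑ ^ 2 := hφ.continuous.measurable.enorm.pow_const 2
  simp only [ENNReal.ofReal_add (mul_nonneg (sq_nonneg t) (sq_nonneg _)) (sq_nonneg _),
    ENNReal.ofReal_mul ht0, ENNReal.ofReal_mul (sq_nonneg t), e, e'] at h1
  rw [lintegral_const_mul _ hφm, lintegral_add_left (hφm.const_mul _), lintegral_const_mul _ hφm,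
    lintegral_enorm_sq_eq, lintegral_enorm_sq_eq, lintegral_enorm_sq_eq] at h1
  exact h1

variable {C : ℝ}

/-- Square integrability on the boundary is read off the trace inequality at `t = 1`, so finiteness
of the surface measure needs no separate argument. -/
lemma IsSmoothTraceConstant.memLp (hC : IsSmoothTraceConstant Ω C) (hΩ : Bornology.IsBounded Ω)
    {φ : R3 → ℂ} (hφ : ContDiff ℝ ∞ φ) : MemLp φ 2 (surfaceMeasure Ω) := by
  refine ⟨hφ.continuous.aestronglyMeasurable, ?_⟩
  have h := hC φ hφ 1 le_rfl
  have h1 := (memLp_restrict_of_continuous hΩ hφ.continuous).2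
  have h2 := (memLp_restrict_of_continuous hΩ (continuous_classicalGrad hφ)).2
  simp only [ENNReal.ofReal_one, one_pow, one_mul] at h
  have h3 := h.trans_lt (ENNReal.mul_lt_top ENNReal.ofReal_lt_top
    (ENNReal.add_lt_top.2 ⟨ENNReal.pow_lt_top h1, ENNReal.pow_lt_top h2⟩))
  exact (ENNReal.pow_lt_top_iff.1 h3).resolve_right (by norm_num)

/-- A smooth function gives rise to a triple. -/
lemma IsSmoothTraceConstant.exists_triple (hC : IsSmoothTraceConstant Ω C)
    (hΩ : Bornology.IsBounded Ω) {φ : R3 → ℂ} (hφ : ContDiff ℝ ∞ φ) :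
    ∃ (P : L2 Ω) (Q : L2Vec Ω) (G : L2Bdry Ω), (P, Q, G) ∈ smoothTriples Ω ∧
      P =ᵐ[volume.restrict Ω] φ ∧ Q =ᵐ[volume.restrict Ω] classicalGrad φ ∧
      G =ᵐ[surfaceMeasure Ω] φ := by
  have h1 := (memLp_restrict_of_continuous hΩ hφ.continuous).coeFn_toLp
  have h2 := (memLp_restrict_of_continuous hΩ (continuous_classicalGrad hφ)).coeFn_toLp
  have h3 := (hC.memLp hΩ hφ).coeFn_toLp
  exact ⟨_, _, _, ⟨φ, hφ, h1, h2, h3⟩, h1, h2, h3⟩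

lemma IsSmoothTraceConstant.le_of_mem (hC : IsSmoothTraceConstant Ω C) (hC0 : 0 ≤ C)
    {t : ℝ} (ht : 1 ≤ t) {p : L2 Ω × L2Vec Ω × L2Bdry Ω} (hp : p ∈ smoothTriples Ω) :
    t * ‖p.2.2‖ ^ 2 ≤ C * (t ^ 2 * ‖p.1‖ ^ 2 + ‖p.2.1‖ ^ 2) := by
  obtain ⟨φ, hφ, h1, h2, h3⟩ := hp
  have h := hC φ hφ t ht
  rw [← eLpNorm_congr_ae h1, ← eLpNorm_congr_ae h2, ← eLpNorm_congr_ae h3, ← Lp.enorm_def,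
    ← Lp.enorm_def, ← Lp.enorm_def, ← ofReal_norm, ← ofReal_norm, ← ofReal_norm,
    ← ENNReal.ofReal_pow (norm_nonneg _), ← ENNReal.ofReal_pow (norm_nonneg _),
    ← ENNReal.ofReal_pow (norm_nonneg _), ← ENNReal.ofReal_mul (by positivity),
    ← ENNReal.ofReal_mul (by positivity), ← ENNReal.ofReal_add (by positivity) (by positivity),
    ← ENNReal.ofReal_mul hC0, ENNReal.ofReal_le_ofReal_iff (by positivity)] at h
  exact h

lemma IsSmoothTraceConstant.le_of_mem_closure (hC : IsSmoothTraceConstant Ω C) (hC0 : 0 ≤ C)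
    {t : ℝ} (ht : 1 ≤ t) {p : L2 Ω × L2Vec Ω × L2Bdry Ω}
    (hp : p ∈ (smoothTriples Ω).topologicalClosure) :
    t * ‖p.2.2‖ ^ 2 ≤ C * (t ^ 2 * ‖p.1‖ ^ 2 + ‖p.2.1‖ ^ 2) := by
  have hcl : IsClosed {p : L2 Ω × L2Vec Ω × L2Bdry Ω |
      t * ‖p.2.2‖ ^ 2 ≤ C * (t ^ 2 * ‖p.1‖ ^ 2 + ‖p.2.1‖ ^ 2)} :=
    isClosed_le (by fun_prop) (by fun_prop)
  exact closure_minimal (fun q hq => hC.le_of_mem hC0 ht hq) hcl hp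

/-- Traces are the limits of triples. -/
lemma IsSmoothTraceConstant.isTrace_iff (hC : IsSmoothTraceConstant Ω C)
    (hΩ : Bornology.IsBounded Ω) (u : H1 Ω) (g : L2Bdry Ω) :
    IsTrace u g ↔ (toL2 u, grad u, g) ∈ (smoothTriples Ω).topologicalClosure := by
  rw [← SetLike.mem_coe, Submodule.topologicalClosure_coe, mem_closure_iff_seq_limit]
  constructor
  · rintro ⟨φ, hφ, h1, h2, h3⟩
    choose P Q G hmem hP hQ hG using fun n => hC.exists_triple hΩ (hφ n)
    exact ⟨fun n => (P n, Q n, G n), hmem, ((tendsto_Lp_iff_of_ae_eq hP).2 h1).prodMk_nhds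
      (((tendsto_Lp_iff_of_ae_eq hQ).2 h2).prodMk_nhds ((tendsto_Lp_iff_of_ae_eq hG).2 h3))⟩
  · rintro ⟨p, hp, hlim⟩
    choose φ hφ h1 h2 h3 using hp
    have l2 := (continuous_snd.tendsto _).comp hlim
    exact ⟨φ, hφ, (tendsto_Lp_iff_of_ae_eq h1).1 ((continuous_fst.tendsto _).comp hlim),
      (tendsto_Lp_iff_of_ae_eq h2).1 ((continuous_fst.tendsto _).comp l2),
      (tendsto_Lp_iff_of_ae_eq h3).1 ((continuous_snd.tendsto _).comp l2)⟩

lemma IsSmoothTraceConstant.exists_isTrace (hC : IsSmoothTraceConstant Ω C) (hC0 : 0 ≤ C)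
    (hΩ : IsAdmissibleDomain Ω) (u : H1 Ω) : ∃ g : L2Bdry Ω, IsTrace u g := by
  obtain ⟨φ, hφ, h1, h2⟩ := exists_contDiff_tendsto hΩ u
  have hb := hΩ.isBounded
  choose P Q G hmem hP hQ hG using fun n => hC.exists_triple hb (hφ n)
  replace hP := (tendsto_Lp_iff_of_ae_eq hP).2 h1
  replace hQ := (tendsto_Lp_iff_of_ae_eq hQ).2 h2
  -- The trace inequality applied to differences turns convergence in H¹ into the Cauchy property of
  -- the boundary values.
  have hGc : CauchySeq G := by
    rw [cauchySeq_iff_tendsto_dist_atTop_0]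
    have d1 := cauchySeq_iff_tendsto_dist_atTop_0.1 hP.cauchySeq
    have d2 := cauchySeq_iff_tendsto_dist_atTop_0.1 hQ.cauchySeq
    have d3 : Tendsto (fun n : ℕ × ℕ => Real.sqrt (C * (dist (P n.1) (P n.2) ^ 2 +
        dist (Q n.1) (Q n.2) ^ 2))) atTop (𝓝 0) := by
      have := (((d1.pow 2).add (d2.pow 2)).const_mul C).sqrt
      simpa using this
    refine squeeze_zero (fun _ => dist_nonneg) (fun n => Real.le_sqrt_of_sq_le ?_) d3
    have := hC.le_of_mem hC0 le_rfl ((smoothTriples Ω).sub_mem (hmem n.1) (hmem n.2))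
    simpa [dist_eq_norm] using this
  obtain ⟨g, hlim⟩ := cauchySeq_tendsto_of_complete hGc
  refine ⟨g, (hC.isTrace_iff hb u g).2 ?_⟩
  exact mem_closure_of_tendsto (hP.prodMk_nhds (hQ.prodMk_nhds hlim))
    (Eventually.of_forall hmem)

/-- The triple `(0, 0, g - g')` lies in the closure, where the trace inequality still holds and
forces the last entry to vanish. -/
lemma IsSmoothTraceConstant.isTrace_unique (hC : IsSmoothTraceConstant Ω C) (hC0 : 0 ≤ C)
    (hΩ : Bornology.IsBounded Ω) {u : H1 Ω} {g g' : L2Bdry Ω} (hg : IsTrace u g)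
    (hg' : IsTrace u g') : g = g' := by
  rw [hC.isTrace_iff hΩ] at hg hg'
  have h := hC.le_of_mem_closure hC0 le_rfl (Submodule.sub_mem _ hg hg')
  simp only [Prod.mk_sub_mk, sub_self, norm_zero] at h
  have h2 : ‖g - g'‖ ^ 2 ≤ 0 := by simpa using h
  rw [← sub_eq_zero, ← norm_eq_zero]
  exact pow_eq_zero_iff two_ne_zero |>.1 (le_antisymm h2 (sq_nonneg _))

theorem existsUnique_isTrace (hΩ : IsAdmissibleDomain Ω) (u : H1 Ω) :
    ∃! g : L2Bdry Ω, IsTrace u g := by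
  obtain ⟨C, hC0, hC⟩ := exists_isSmoothTraceConstant hΩ
  obtain ⟨g, hg⟩ := hC.exists_isTrace hC0 hΩ u
  exact ⟨g, hg, fun g' hg' => hC.isTrace_unique hC0 hΩ.isBounded hg' hg⟩

lemma isTrace_trace (hΩ : IsAdmissibleDomain Ω) (u : H1 Ω) : IsTrace u (trace u) := by
  have h := (existsUnique_isTrace hΩ u).exists
  rw [trace, dif_pos h]
  exact h.choose_spec

lemma trace_eq (hΩ : IsAdmissibleDomain Ω) {u : H1 Ω} {g : L2Bdry Ω} (hg : IsTrace u g) :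
    trace u = g :=
  (existsUnique_isTrace hΩ u).unique (isTrace_trace hΩ u) hg

/-- The trace operator as a linear map. -/
noncomputable def traceLinear (hΩ : IsAdmissibleDomain Ω) : H1 Ω →ₗ[ℂ] L2Bdry Ω where
  toFun := trace
  map_add' u v := by
    obtain ⟨C, hC0, hC⟩ := exists_isSmoothTraceConstant hΩ
    refine trace_eq hΩ ?_
    have hu := isTrace_trace hΩ u
    have hv := isTrace_trace hΩ v
    rw [hC.isTrace_iff hΩ.isBounded] at hu hv ⊢
    exact Submodule.add_mem _ hu hv
  map_smul' c u := by
    obtain ⟨C, hC0, hC⟩ := exists_isSmoothTraceConstant hΩ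
    refine trace_eq hΩ ?_
    have hu := isTrace_trace hΩ u
    rw [hC.isTrace_iff hΩ.isBounded] at hu ⊢
    exact Submodule.smul_mem _ c hu

lemma IsSmoothTraceConstant.norm_trace_sq_le (hC : IsSmoothTraceConstant Ω C) (hC0 : 0 ≤ C)
    (hΩ : IsAdmissibleDomain Ω) {t : ℝ} (ht : 1 ≤ t) (u : H1 Ω) :
    t * ‖trace u‖ ^ 2 ≤ C * wnorm t u ^ 2 := by
  have h := hC.le_of_mem_closure hC0 ht
    ((hC.isTrace_iff hΩ.isBounded u _).1 (isTrace_trace hΩ u))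
  rw [wnorm, Real.sq_sqrt (by positivity), add_comm]
  exact h

end Traces

/-! ### Completeness of H¹ and its bounded operators. -/

section Sobolev

/-- Each weak-gradient identity equates two continuous functionals, since its integrals are inner
products with fixed square-integrable fields built from the test function. -/
lemma isClosed_H1 (Ω : Set R3) : IsClosed (H1 Ω : Set (WithLp 2 (L2 Ω × L2Vec Ω))) := by
  have h : (H1 Ω : Set (WithLp 2 (L2 Ω × L2Vec Ω))) =
      ⋂ (φ : R3 → ℝ) (_ : IsTestFunction Ω φ) (i : Fin 3),
        {p | ∫ x in Ω, p.fst x * ((partialDeriv i φ x : ℝ) : ℂ) =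
          - ∫ x in Ω, (p.snd x) i * (φ x : ℂ)} := by
    ext p
    simp only [Set.mem_iInter]
    rfl
  rw [h]
  refine isClosed_iInter fun φ => isClosed_iInter fun hφ => isClosed_iInter fun i => ?_
  have h1 : ∀ f : L2 Ω, ∫ x in Ω, f x * ((partialDeriv i φ x : ℝ) : ℂ) =
      inner ℂ ((hφ.memLp_partialDeriv i (volume.restrict Ω)).toLp _) f := by
    intro f
    rw [L2.inner_def]
    refine integral_congr_ae ?_
    filter_upwards [(hφ.memLp_partialDeriv i (volume.restrict Ω)).coeFn_toLp] with x hx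
    rw [hx]
    simp
  have hm : MemLp (fun x => (EuclideanSpace.single i (φ x : ℂ) : C3)) 2 (volume.restrict Ω) := by
    refine (hφ.memLp (volume.restrict Ω)).of_le ?_ (Eventually.of_forall fun x => by simp)
    have hc : Continuous fun x => (EuclideanSpace.single i (φ x : ℂ) : C3) := by
      refine (PiLp.continuous_toLp 2 _).comp ?_
      exact (continuous_single i).comp
        (Complex.continuous_ofReal.comp hφ.contDiff.continuous)
    exact hc.aestronglyMeasurable
  have h2 : ∀ f : L2Vec Ω, ∫ x in Ω, (f x) i * (φ x : ℂ) = inner ℂ (hm.toLp _) f := by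
    intro f
    rw [L2.inner_def]
    refine integral_congr_ae ?_
    filter_upwards [hm.coeFn_toLp] with x hx
    rw [hx, EuclideanSpace.inner_single_left]
    simp [mul_comm]
  simp only [h1, h2]
  refine isClosed_eq ?_ ?_
  · exact continuous_const.inner (WithLp.continuous_fst 2 _ _)
  · exact (continuous_const.inner (WithLp.continuous_snd 2 _ _)).neg

instance : CompleteSpace (H1 Ω) := (isClosed_H1 Ω).completeSpace_coe

lemma norm_sq_eq (u : H1 Ω) : ‖u‖ ^ 2 = ‖toL2 u‖ ^ 2 + ‖grad u‖ ^ 2 :=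
  WithLp.prod_norm_sq_eq_of_L2 (u : WithLp 2 (L2 Ω × L2Vec Ω))

lemma wnorm_sq (ρ : ℝ) (u : H1 Ω) : wnorm ρ u ^ 2 = ‖grad u‖ ^ 2 + ρ ^ 2 * ‖toL2 u‖ ^ 2 :=
  Real.sq_sqrt (by positivity)

lemma wnorm_nonneg (ρ : ℝ) (u : H1 Ω) : 0 ≤ wnorm ρ u := Real.sqrt_nonneg _

lemma norm_le_wnorm {ρ : ℝ} (hρ : 1 ≤ ρ) (u : H1 Ω) : ‖u‖ ≤ wnorm ρ u := by
  refine Real.le_sqrt_of_sq_le ?_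
  rw [norm_sq_eq, add_comm]
  have : 1 ≤ ρ ^ 2 := by nlinarith
  nlinarith [sq_nonneg ‖toL2 u‖]

lemma mul_norm_toL2_le_wnorm {ρ : ℝ} (u : H1 Ω) : ρ * ‖toL2 u‖ ≤ wnorm ρ u := by
  refine Real.le_sqrt_of_sq_le ?_
  nlinarith [sq_nonneg ‖grad u‖]

lemma norm_toL2_le_wnorm {ρ : ℝ} (hρ : 1 ≤ ρ) (u : H1 Ω) : ‖toL2 u‖ ≤ wnorm ρ u :=
  (le_mul_of_one_le_left (norm_nonneg _) hρ).trans (mul_norm_toL2_le_wnorm u)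

/-- The embedding of `H¹(Ω)` into `L²(Ω)`. -/
noncomputable def toL2CLM (Ω : Set R3) : H1 Ω →L[ℂ] L2 Ω :=
  LinearMap.mkContinuous ⟨⟨toL2, fun _ _ => rfl⟩, fun _ _ => rfl⟩ 1 fun u => by
    rw [one_mul]
    refine le_of_sq_le_sq ?_ (norm_nonneg _)
    rw [norm_sq_eq]
    exact le_add_of_nonneg_right (sq_nonneg _)

/-- The gradient as an operator. -/
noncomputable def gradCLM (Ω : Set R3) : H1 Ω →L[ℂ] L2Vec Ω :=
  LinearMap.mkContinuous ⟨⟨grad, fun _ _ => rfl⟩, fun _ _ => rfl⟩ 1 fun u => by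
    rw [one_mul]
    refine le_of_sq_le_sq ?_ (norm_nonneg _)
    rw [norm_sq_eq]
    exact le_add_of_nonneg_left (sq_nonneg _)

lemma toL2CLM_apply (u : H1 Ω) : toL2CLM Ω u = toL2 u := rfl

lemma gradCLM_apply (u : H1 Ω) : gradCLM Ω u = grad u := rfl

lemma exists_traceCLM (hΩ : IsAdmissibleDomain Ω) :
    ∃ T : H1 Ω →L[ℂ] L2Bdry Ω, ∀ u, T u = trace u := by
  obtain ⟨C, hC0, hC⟩ := exists_isSmoothTraceConstant hΩ
  refine ⟨(traceLinear hΩ).mkContinuous (Real.sqrt C) fun u => ?_, fun u => rfl⟩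
  have h := hC.norm_trace_sq_le hC0 hΩ le_rfl u
  have h2 : wnorm 1 u ^ 2 = ‖u‖ ^ 2 := by rw [wnorm_sq, norm_sq_eq]; ring
  rw [one_mul, h2] at h
  refine le_of_sq_le_sq ?_ (by positivity)
  rw [mul_pow, Real.sq_sqrt hC0]
  exact h

end Sobolev

/-! ### Lax–Milgram on closed subspaces. -/

section LaxMilgram

/-- The Lax-Milgram lemma on a closed subspace. -/
theorem existsUnique_inner_eq_of_coercive {E : Type*} [NormedAddCommGroup E]
    [InnerProductSpace ℂ E] [CompleteSpace E] (A : E →L[ℂ] E) {c : ℝ} (hc : 0 < c)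
    (hA : ∀ u, c * ‖u‖ ^ 2 ≤ ‖(inner ℂ u (A u) : ℂ)‖) {S : Submodule ℂ E}
    (hS : IsClosed (S : Set E)) (w : E) :
    ∃! u : E, u ∈ S ∧ ∀ v ∈ S, (inner ℂ v (A u) : ℂ) = inner ℂ v w := by
  have : CompleteSpace S := hS.completeSpace_coe
  -- The compression of `A` to `S` inherits coercivity, and the variational problem becomes an
  -- equation for it.
  let AS : S →L[ℂ] S := S.subtypeL.adjoint ∘L A ∘L S.subtypeL
  have hAS : ∀ u v : S, (inner ℂ v (AS u) : ℂ) = inner ℂ (v : E) (A u) := fun u v => by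
    simp only [AS, ContinuousLinearMap.comp_apply, ContinuousLinearMap.adjoint_inner_right,
      Submodule.subtypeL_apply]
  have hunit : IsUnit AS := by
    refine ContinuousLinearMap.isUnit_of_forall_le_norm_inner_map AS (c := ⟨c, hc.le⟩) hc
      fun x => ?_
    rw [← inner_conj_symm, RCLike.norm_conj, hAS, mul_comm]
    exact hA x
  have hiff : ∀ u : S, (∀ v ∈ S, (inner ℂ v (A u) : ℂ) = inner ℂ v w) ↔
      AS u = S.subtypeL.adjoint w := by
    intro u
    rw [ext_iff_inner_left ℂ]
    constructor
    · intro h v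
      rw [hAS, h v v.2, ContinuousLinearMap.adjoint_inner_right, Submodule.subtypeL_apply]
    · intro h v hv
      have := h ⟨v, hv⟩
      rwa [hAS, ContinuousLinearMap.adjoint_inner_right] at this
  have hbij := ContinuousLinearMap.isUnit_iff_bijective.1 hunit
  obtain ⟨u, hu⟩ := hbij.2 (S.subtypeL.adjoint w)
  refine ⟨u, ⟨u.2, (hiff u).2 hu⟩, fun u' ⟨hu', h⟩ => ?_⟩
  have := (hiff ⟨u', hu'⟩).1 h
  exact congrArg Subtype.val (hbij.1 (this.trans hu.symm))

end LaxMilgram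

/-! ### Coercivity and continuity of the sesquilinear form. -/

section Forms

variable {ζ : ℂ}

lemma exists_formA_operator (hΩ : IsAdmissibleDomain Ω) (ζ : ℂ) :
    ∃ A : H1 Ω →L[ℂ] H1 Ω, ∀ u v, formA ζ u v = inner ℂ v (A u) := by
  obtain ⟨T, hT⟩ := exists_traceCLM hΩ
  refine ⟨(gradCLM Ω).adjoint ∘L gradCLM Ω + (toL2CLM Ω).adjoint ∘L (ζ ^ 2 • toL2CLM Ω) +
    T.adjoint ∘L (ζ • T), fun u v => ?_⟩
  simp only [formA, formA0, formB, add_apply, smul_apply,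
    ContinuousLinearMap.comp_apply, inner_add_right, inner_smul_right,
    ContinuousLinearMap.adjoint_inner_right, hT, toL2CLM_apply, gradCLM_apply]

/-- The problem for the conjugate of `ζ` is thereby the adjoint of the one for `ζ`, as the duality
argument requires. -/
lemma formA_conj_symm (ζ : ℂ) (u v : H1 Ω) :
    formA (starRingEnd ℂ ζ) u v = starRingEnd ℂ (formA ζ v u) := by
  simp only [formA, formA0, formB, map_add, inner_conj_symm, inner_smul_right, map_mul, map_pow]

/-- Coercivity of the form, up to a rotation. -/
lemma re_div_norm_mul_wnorm_sq_le (hζ : 0 < ζ.re) (u : H1 Ω) :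
    ζ.re / ‖ζ‖ * wnorm ‖ζ‖ u ^ 2 ≤ ‖formA ζ u u‖ := by
  have h0 : 0 < ‖ζ‖ := norm_pos_iff.2 fun h => by simp [h] at hζ
  set g := ‖grad u‖ ^ 2
  set m := ‖toL2 u‖ ^ 2
  set b := ‖trace u‖ ^ 2
  have hA : formA ζ u u = (g : ℂ) + ζ ^ 2 * (m : ℂ) + ζ * (b : ℂ) := by
    simp only [formA, formA0, formB, inner_smul_right, inner_self_eq_norm_sq_to_K]
    simp [g, m, b]
  -- Multiplication by the conjugate turns `ζ ^ 2` into `‖ζ‖ ^ 2 * ζ` and `ζ` into `‖ζ‖ ^ 2`, so all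
  -- three terms acquire nonnegative real part.
  have hre : (starRingEnd ℂ ζ * formA ζ u u).re =
      ζ.re * g + ‖ζ‖ ^ 2 * ζ.re * m + ‖ζ‖ ^ 2 * b := by
    rw [hA, ← Complex.normSq_eq_norm_sq, Complex.normSq_apply]
    simp [pow_two]
    ring
  have hle : ζ.re * wnorm ‖ζ‖ u ^ 2 ≤ ‖ζ‖ * ‖formA ζ u u‖ := by
    calc ζ.re * wnorm ‖ζ‖ u ^ 2 ≤ ζ.re * g + ‖ζ‖ ^ 2 * ζ.re * m + ‖ζ‖ ^ 2 * b := by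
          rw [wnorm_sq]
          have : 0 ≤ ‖ζ‖ ^ 2 * b := by positivity
          simp only [g, m] at *
          linarith
      _ ≤ ‖starRingEnd ℂ ζ * formA ζ u u‖ := by rw [← hre]; exact Complex.re_le_norm _
      _ = _ := by rw [norm_mul, RCLike.norm_conj]
  rw [div_mul_eq_mul_div, div_le_iff₀ h0, mul_comm ‖formA ζ u u‖]
  exact hle

lemma norm_formA0_le (ζ : ℂ) (u v : H1 Ω) :
    ‖formA0 ζ u v‖ ≤ wnorm ‖ζ‖ u * wnorm ‖ζ‖ v := by
  have h1 : ‖formA0 ζ u v‖ ≤ ‖grad u‖ * ‖grad v‖ + (‖ζ‖ * ‖toL2 u‖) * (‖ζ‖ * ‖toL2 v‖) := by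
    refine (norm_add_le _ _).trans (add_le_add ?_ ?_)
    · rw [mul_comm]; exact norm_inner_le_norm _ _
    · rw [inner_smul_right, norm_mul, norm_pow]
      calc _ ≤ ‖ζ‖ ^ 2 * (‖toL2 v‖ * ‖toL2 u‖) := by gcongr; exact norm_inner_le_norm _ _
        _ = _ := by ring
  refine h1.trans (le_of_sq_le_sq ?_ (mul_nonneg (wnorm_nonneg _ _) (wnorm_nonneg _ _)))
  rw [mul_pow, wnorm_sq, wnorm_sq]
  nlinarith [sq_nonneg (‖grad u‖ * (‖ζ‖ * ‖toL2 v‖) - ‖grad v‖ * (‖ζ‖ * ‖toL2 u‖))]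

theorem exists_robin_and_continuityConstant (hΩ : IsAdmissibleDomain Ω) :
    ∃ Cb : ℝ, 0 ≤ Cb ∧ IsRobinConstant Ω Cb ∧ IsContinuityConstant Ω Cb := by
  obtain ⟨C, hC0, hC⟩ := exists_isSmoothTraceConstant hΩ
  have hR : IsRobinConstant Ω C := by
    intro ζ _ hζ u v
    -- Taking `t = ‖ζ‖` absorbs the factor `‖ζ‖` of the boundary form exactly, a square root of it
    -- in each argument.
    have hu := hC.norm_trace_sq_le hC0 hΩ hζ u
    have hv := hC.norm_trace_sq_le hC0 hΩ hζ v
    have h1 : ‖formB ζ u v‖ ≤ ‖ζ‖ * (‖trace u‖ * ‖trace v‖) := by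
      rw [formB, inner_smul_right, norm_mul, mul_comm ‖trace u‖]
      gcongr
      exact norm_inner_le_norm _ _
    refine h1.trans (le_of_sq_le_sq ?_ ?_)
    · calc (‖ζ‖ * (‖trace u‖ * ‖trace v‖)) ^ 2
          = (‖ζ‖ * ‖trace u‖ ^ 2) * (‖ζ‖ * ‖trace v‖ ^ 2) := by ring
        _ ≤ (C * wnorm ‖ζ‖ u ^ 2) * (C * wnorm ‖ζ‖ v ^ 2) := by gcongr
        _ = _ := by ring
    · exact mul_nonneg (mul_nonneg hC0 (wnorm_nonneg _ _)) (wnorm_nonneg _ _)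
  refine ⟨C, hC0, hR, fun ζ h0 h1 u v => ?_⟩
  calc ‖formA ζ u v‖ ≤ ‖formA0 ζ u v‖ + ‖formB ζ u v‖ := norm_add_le _ _
    _ ≤ wnorm ‖ζ‖ u * wnorm ‖ζ‖ v + C * wnorm ‖ζ‖ u * wnorm ‖ζ‖ v :=
        add_le_add (norm_formA0_le ζ u v) (hR ζ h0 h1 u v)
    _ = _ := by ring

lemma formA_sub_left (hΩ : IsAdmissibleDomain Ω) (ζ : ℂ) (u u' v : H1 Ω) :
    formA ζ (u - u') v = formA ζ u v - formA ζ u' v := by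
  obtain ⟨A, hA⟩ := exists_formA_operator hΩ ζ
  simp only [hA, map_sub, inner_sub_right]

lemma formA_sub_right (hΩ : IsAdmissibleDomain Ω) (ζ : ℂ) (u v v' : H1 Ω) :
    formA ζ u (v - v') = formA ζ u v - formA ζ u v' := by
  obtain ⟨A, hA⟩ := exists_formA_operator hΩ ζ
  simp only [hA, inner_sub_left]

/-- Variational problems on closed subspaces are well posed. -/
theorem existsUnique_formA_eq (hΩ : IsAdmissibleDomain Ω) (hζ : 0 < ζ.re) (h1 : 1 ≤ ‖ζ‖)
    {S : Submodule ℂ (H1 Ω)} (hS : IsClosed (S : Set (H1 Ω))) (w : H1 Ω) :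
    ∃! u : H1 Ω, u ∈ S ∧ ∀ v ∈ S, formA ζ u v = inner ℂ v w := by
  obtain ⟨A, hA⟩ := exists_formA_operator hΩ ζ
  have hc : 0 < ζ.re / ‖ζ‖ := by positivity
  simp only [hA]
  refine existsUnique_inner_eq_of_coercive A hc (fun u => ?_) hS w
  rw [← hA]
  refine le_trans ?_ (re_div_norm_mul_wnorm_sq_le hζ u)
  have := norm_le_wnorm h1 u
  gcongr

end Forms

/-! ### Galerkin approximation and the duality argument. -/

section Galerkin

variable {ζ : ℂ} {S : Submodule ℂ (H1 Ω)}

lemma existsUnique_isGalerkin (hΩ : IsAdmissibleDomain Ω) (hζ : 0 < ζ.re) (h1 : 1 ≤ ‖ζ‖)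
    (hS : IsClosed (S : Set (H1 Ω))) (u : H1 Ω) : ∃! uS : H1 Ω, IsGalerkin ζ S u uS := by
  obtain ⟨A, hA⟩ := exists_formA_operator hΩ ζ
  refine (existsUnique_congr fun uS => ?_).1 (existsUnique_formA_eq hΩ hζ h1 hS (A u))
  refine and_congr_right fun _ => forall₂_congr fun v _ => ?_
  rw [formA_sub_left hΩ, sub_eq_zero, eq_comm, hA u v]

lemma re_starRingEnd_pos (hζ : 0 < ζ.re) : 0 < (starRingEnd ℂ ζ).re := by
  rwa [Complex.conj_re]

lemma existsUnique_isAdjointSolution (hΩ : IsAdmissibleDomain Ω) (hζ : 0 < ζ.re) (h1 : 1 ≤ ‖ζ‖)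
    (f : L2 Ω) : ∃! z : H1 Ω, IsAdjointSolution ζ f z := by
  have h := existsUnique_formA_eq hΩ (ζ := starRingEnd ℂ ζ) (re_starRingEnd_pos hζ)
    (by rwa [RCLike.norm_conj]) (S := ⊤) (by simp) ((toL2CLM Ω).adjoint f)
  refine (existsUnique_congr fun z => ?_).1 h
  simp only [Submodule.mem_top, true_and, forall_const, ContinuousLinearMap.adjoint_inner_right,
    toL2CLM_apply]
  rfl

lemma bddBelow_range_wnorm_sub (ρ : ℝ) (S : Submodule ℂ (H1 Ω)) (u : H1 Ω) :
    BddBelow (Set.range fun v : S => wnorm ρ (u - (v : H1 Ω))) :=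
  ⟨0, by rintro _ ⟨v, rfl⟩; exact wnorm_nonneg _ _⟩

/-- Quasi-optimality of the Galerkin approximation. -/
theorem IsGalerkin.wnorm_sub_le (hΩ : IsAdmissibleDomain Ω) {Cb : ℝ}
    (hCb : IsContinuityConstant Ω Cb) (hζ : 0 < ζ.re) (h1 : 1 ≤ ‖ζ‖) {u uS : H1 Ω}
    (h : IsGalerkin ζ S u uS) :
    wnorm ‖ζ‖ (u - uS) ≤ ‖ζ‖ / ζ.re * (1 + Cb) * ⨅ v : S, wnorm ‖ζ‖ (u - (v : H1 Ω)) := by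
  have hn : 0 < ‖ζ‖ := by linarith
  set e := u - uS with he
  have key : ∀ v : S, wnorm ‖ζ‖ e * wnorm ‖ζ‖ e ≤
      (‖ζ‖ / ζ.re * (1 + Cb) * wnorm ‖ζ‖ (u - (v : H1 Ω))) * wnorm ‖ζ‖ e := by
    intro v
    -- Galerkin orthogonality: the second argument may be shifted by the element `uS - v` of `S`.
    have e1 : formA ζ e e = formA ζ e (u - (v : H1 Ω)) := by
      have h3 : e = (u - (v : H1 Ω)) - (uS - (v : H1 Ω)) := by rw [he]; abel
      have h4 := formA_sub_right hΩ ζ e (u - (v : H1 Ω)) (uS - (v : H1 Ω))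
      rw [← h3, h.2 (uS - v) (S.sub_mem h.1 v.2), sub_zero] at h4
      exact h4
    have h2 := re_div_norm_mul_wnorm_sq_le hζ e
    have h3 := hCb ζ hζ.le h1 e (u - (v : H1 Ω))
    rw [← e1] at h3
    have h4 := h2.trans h3
    rw [div_mul_eq_mul_div, div_le_iff₀ hn] at h4
    have h5 : wnorm ‖ζ‖ e ^ 2 ≤
        ((1 + Cb) * wnorm ‖ζ‖ e * wnorm ‖ζ‖ (u - (v : H1 Ω)) * ‖ζ‖) / ζ.re := by
      rw [le_div_iff₀ hζ, mul_comm]; exact h4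
    calc _ = wnorm ‖ζ‖ e ^ 2 := by ring
      _ ≤ _ := h5
      _ = _ := by ring
  rcases (wnorm_nonneg ‖ζ‖ e).eq_or_lt with h0 | h0
  · have hu : ∃ v : S, u = v := by
      have h2 := norm_le_wnorm h1 e
      rw [← h0] at h2
      have h3 : e = 0 := norm_le_zero_iff.1 h2
      exact ⟨⟨uS, h.1⟩, sub_eq_zero.1 h3⟩
    obtain ⟨v, hv⟩ := hu
    have hinf : ⨅ v : S, wnorm ‖ζ‖ (u - (v : H1 Ω)) = 0 := by
      refine le_antisymm ?_ (Real.iInf_nonneg fun v => wnorm_nonneg _ _)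
      refine (ciInf_le (bddBelow_range_wnorm_sub _ _ _) ⟨uS, h.1⟩).trans ?_
      exact h0.symm.le
    rw [hinf, mul_zero, ← h0]
  · have hC : 0 ≤ ‖ζ‖ / ζ.re * (1 + Cb) := by
      by_contra! hneg
      have h2 := le_of_mul_le_mul_right (key 0) h0
      have h3 := mul_nonpos_of_nonpos_of_nonneg hneg.le (wnorm_nonneg ‖ζ‖ (u - ((0 : S) : H1 Ω)))
      linarith
    rw [Real.mul_iInf_of_nonneg hC]
    exact le_ciInf fun v => le_of_mul_le_mul_right (key v) h0

lemma IsAdjointSolution.wnorm_le (hζ : 0 < ζ.re) (h1 : 1 ≤ ‖ζ‖) {f : L2 Ω}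
    {z : H1 Ω} (hz : IsAdjointSolution ζ f z) : wnorm ‖ζ‖ z ≤ ‖ζ‖ / ζ.re * ‖f‖ := by
  have hn : 0 < ‖ζ‖ := by linarith
  have h2 := re_div_norm_mul_wnorm_sq_le (re_starRingEnd_pos hζ) z
  rw [hz z, RCLike.norm_conj, Complex.conj_re, div_mul_eq_mul_div, div_le_iff₀ hn] at h2
  have h3 : ‖(inner ℂ (toL2 z) f : ℂ)‖ ≤ wnorm ‖ζ‖ z * ‖f‖ :=
    (norm_inner_le_norm _ _).trans (by gcongr; exact norm_toL2_le_wnorm h1 z)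
  have h4 : (ζ.re * wnorm ‖ζ‖ z) * wnorm ‖ζ‖ z ≤ (‖ζ‖ * ‖f‖) * wnorm ‖ζ‖ z := by
    have := mul_le_mul_of_nonneg_right h3 hn.le
    linarith
  rcases (wnorm_nonneg ‖ζ‖ z).eq_or_lt with h0 | h0
  · rw [← h0]; positivity
  · rw [div_mul_eq_mul_div, le_div_iff₀ hζ, mul_comm]
    exact le_of_mul_le_mul_right h4 h0

lemma exists_L2_ne_zero (hΩ : IsAdmissibleDomain Ω) : ∃ f : L2 Ω, f ≠ 0 := by
  obtain ⟨x₀, r, hr, hball, -⟩ := hΩ.starShaped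
  have hne : volume Ω ≠ 0 :=
    (hΩ.isOpen.measure_pos volume ⟨x₀, hball (Metric.mem_ball_self hr)⟩).ne'
  have : IsFiniteMeasure (volume.restrict Ω) := ⟨by simpa using hΩ.isBounded.measure_lt_top⟩
  refine ⟨(memLp_const (1 : ℂ)).toLp _, fun h => ?_⟩
  have h2 := (memLp_const (1 : ℂ) (p := 2) (μ := volume.restrict Ω)).coeFn_toLp
  rw [h] at h2
  have h3 : ∀ᵐ x ∂(volume.restrict Ω), False := by
    filter_upwards [h2, Lp.coeFn_zero ℂ 2 (volume.restrict Ω)] with x hx hx'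
    rw [hx'] at hx
    exact zero_ne_one hx
  rw [eventually_false_iff_eq_bot, ae_eq_bot, Measure.restrict_eq_zero] at h3
  exact hne h3

/-- A real `sSup` is a genuine supremum only for nonempty bounded sets. Nonemptiness holds because
`Ω` has positive measure; the bound comes from choosing `v = 0` and the stability of the adjoint
solution. -/
theorem isLUB_eta (hΩ : IsAdmissibleDomain Ω) (hζ : 0 < ζ.re) (h1 : 1 ≤ ‖ζ‖)
    (S : Submodule ℂ (H1 Ω)) : IsLUB (adjointRatios ζ S) (eta ζ S) := by
  refine isLUB_csSup ?_ ⟨‖ζ‖ / ζ.re, ?_⟩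
  · obtain ⟨f, hf⟩ := exists_L2_ne_zero hΩ
    obtain ⟨z, hz⟩ := (existsUnique_isAdjointSolution hΩ hζ h1 f).exists
    exact ⟨_, f, z, hf, hz, rfl⟩
  · rintro _ ⟨f, z, hf, hz, rfl⟩
    have hf0 : 0 < ‖f‖ := norm_pos_iff.2 hf
    have hb : BddBelow (Set.range fun v : S => wnorm ‖ζ‖ (z - (v : H1 Ω)) / ‖f‖) :=
      ⟨0, by rintro _ ⟨v, rfl⟩; exact div_nonneg (wnorm_nonneg _ _) hf0.le⟩
    refine (ciInf_le hb 0).trans ?_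
    rw [div_le_iff₀ hf0, Submodule.coe_zero, sub_zero]
    exact hz.wnorm_le hζ h1

/-- The duality estimate in the `L²` norm. -/
theorem IsGalerkin.norm_toL2_sub_le (hΩ : IsAdmissibleDomain Ω) {Cb : ℝ}
    (hCb : IsContinuityConstant Ω Cb) (hζ : 0 < ζ.re) (h1 : 1 ≤ ‖ζ‖) {u uS : H1 Ω}
    (h : IsGalerkin ζ S u uS) :
    ‖toL2 (u - uS)‖ ≤ (1 + Cb) * eta ζ S * wnorm ‖ζ‖ (u - uS) := by
  set e := u - uS with he
  have hn : 0 < ‖ζ‖ := by linarith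
  -- `eta` involves only nonzero data, so duality needs a nonzero L² error; otherwise only the sign
  -- of the right-hand side matters.
  rcases eq_or_ne (toL2 e) 0 with h0 | h0
  · rcases (wnorm_nonneg ‖ζ‖ e).eq_or_lt with hw | hw
    · rw [h0, ← hw]; simp
    · have hC : 0 ≤ 1 + Cb := by
        have := (norm_nonneg _).trans (hCb ζ hζ.le h1 e e)
        rw [mul_assoc] at this
        exact nonneg_of_mul_nonneg_left this (mul_pos hw hw)
      have heta : 0 ≤ eta ζ S := by
        refine Real.sSup_nonneg ?_
        rintro _ ⟨f, z, -, -, rfl⟩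
        exact Real.iInf_nonneg fun v => div_nonneg (wnorm_nonneg _ _) (norm_nonneg _)
      rw [h0, norm_zero]
      positivity
  · have hf0 : 0 < ‖toL2 e‖ := norm_pos_iff.2 h0
    have hw : 0 < wnorm ‖ζ‖ e := hf0.trans_le (norm_toL2_le_wnorm h1 e)
    have hC : 0 ≤ 1 + Cb := by
      have := (norm_nonneg _).trans (hCb ζ hζ.le h1 e e)
      rw [mul_assoc] at this
      exact nonneg_of_mul_nonneg_left this (mul_pos hw hw)
    obtain ⟨z, hz⟩ := (existsUnique_isAdjointSolution hΩ hζ h1 (toL2 e)).exists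
    have hdual : ‖formA ζ e z‖ = ‖toL2 e‖ ^ 2 := by
      have h2 := hz e
      rw [formA_conj_symm] at h2
      rw [← RCLike.norm_conj, h2, inner_self_eq_norm_sq_to_K]
      simp
    -- By Galerkin orthogonality any element of `S` may be subtracted from the dual solution.
    have hv : ∀ v : S, ‖toL2 e‖ ≤
        ((1 + Cb) * wnorm ‖ζ‖ e) * (wnorm ‖ζ‖ (z - (v : H1 Ω)) / ‖toL2 e‖) := by
      intro v
      have h2 := hCb ζ hζ.le h1 e (z - v)
      rw [formA_sub_right hΩ, h.2 v v.2, sub_zero, hdual] at h2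
      rw [mul_div_assoc', le_div_iff₀ hf0, ← pow_two]
      exact h2
    have hle : ‖toL2 e‖ ≤ ((1 + Cb) * wnorm ‖ζ‖ e) *
        ⨅ v : S, wnorm ‖ζ‖ (z - (v : H1 Ω)) / ‖toL2 e‖ := by
      rw [Real.mul_iInf_of_nonneg (by positivity)]
      exact le_ciInf hv
    have heta := (isLUB_eta hΩ hζ h1 S).1 ⟨toL2 e, z, h0, hz, rfl⟩
    calc ‖toL2 e‖ ≤ _ := hle
      _ ≤ ((1 + Cb) * wnorm ‖ζ‖ e) * eta ζ S := by gcongr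
      _ = _ := by ring

end Galerkin

end LossyHelmholtz

theorem mainTheorem9 (Ω : Set LossyHelmholtz.R3) (hΩ : LossyHelmholtz.IsAdmissibleDomain Ω) :
    -- the trace operator is well defined
    (∀ u : LossyHelmholtz.H1 Ω, ∃! g : LossyHelmholtz.L2Bdry Ω, LossyHelmholtz.IsTrace u g) ∧
    -- a constant `C_b` that does not depend on `ζ` exists
    (∃ Cb : ℝ, 0 ≤ Cb ∧ LossyHelmholtz.IsRobinConstant Ω Cb ∧
      LossyHelmholtz.IsContinuityConstant Ω Cb) ∧
    -- the estimates hold with every such constant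
    (∀ Cb : ℝ, LossyHelmholtz.IsContinuityConstant Ω Cb →
      ∀ ζ : ℂ, 0 < ζ.re → 1 ≤ ‖ζ‖ →
      ∀ S : Submodule ℂ (LossyHelmholtz.H1 Ω), IsClosed (S : Set (LossyHelmholtz.H1 Ω)) →
        -- the adjoint problem is well posed and `η(S)` is a finite supremum
        (∀ f : LossyHelmholtz.L2 Ω, ∃! z : LossyHelmholtz.H1 Ω,
          LossyHelmholtz.IsAdjointSolution ζ f z) ∧
        IsLUB (LossyHelmholtz.adjointRatios ζ S) (LossyHelmholtz.eta ζ S) ∧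
        ∀ u : LossyHelmholtz.H1 Ω,
          (∃! uS : LossyHelmholtz.H1 Ω, LossyHelmholtz.IsGalerkin ζ S u uS) ∧
          ∀ uS : LossyHelmholtz.H1 Ω, LossyHelmholtz.IsGalerkin ζ S u uS →
            LossyHelmholtz.wnorm ‖ζ‖ (u - uS) ≤
              ‖ζ‖ / ζ.re * (1 + Cb) *
                ⨅ v : S, LossyHelmholtz.wnorm ‖ζ‖ (u - (v : LossyHelmholtz.H1 Ω)) ∧
            ‖LossyHelmholtz.toL2 (u - uS)‖ ≤
              (1 + Cb) * LossyHelmholtz.eta ζ S * LossyHelmholtz.wnorm ‖ζ‖ (u - uS)) := by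
  refine ⟨fun u => LossyHelmholtz.existsUnique_isTrace hΩ u,
    LossyHelmholtz.exists_robin_and_continuityConstant hΩ, fun Cb hCb ζ hζ h1 S hS => ?_⟩
  refine ⟨fun f => LossyHelmholtz.existsUnique_isAdjointSolution hΩ hζ h1 f,
    LossyHelmholtz.isLUB_eta hΩ hζ h1 S, fun u => ?_⟩
  exact ⟨LossyHelmholtz.existsUnique_isGalerkin hΩ hζ h1 hS u, fun uS h =>
    ⟨h.wnorm_sub_le hΩ hCb hζ h1, h.norm_toL2_sub_le hΩ hCb hζ h1⟩⟩
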